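/- Let $M$ be a closed 3-manifold (compact, Hausdorff, without boundary) and let $\mathcal T$ be a triangulation of $M$, i.e. a finite abstract simplicial complex with vertices $1,\dots,N$ whose geometric realization is homeomorphic to $M$; let $\mathcal T_3$ be its set of tetrahedra. For $r\in\mathbb R^N_{>0}$ and a tetrahedron $\{ijkl\}\in\mathcal T_3$ put $$Q_{ijkl}(r)=\Big(\tfrac1{r_i}+\tfrac1{r_j}+\tfrac1{r_k}+\tfrac1{r_l}\Big)^2-2\Big(\tfrac1{r_i^2}+\tfrac1{r_j^2}+\tfrac1{r_k^2}+\tfrac1{r_l^2}\Big),$$ and let $\mathcal M_{\mathcal T}=\{r\in\mathbb R^N_{>0}: Q_{ijkl}(r)>0\ \text{for all}\ \{ijkl\}\in\mathcal T_3\}$ be the space of (real) ball packings. For $r\in\mathcal M_{\mathcal T}$ every $\{ijkl\}\in\mathcal T_3$ is realized as a nondegenerate Euclidean tetrahedron with edge lengths $l_{ij}=r_i+r_j$; let $\alpha_{ijkl}$ be its solid angle at the vertex $i$. Define $$K_i=4\pi-\sum_{\{ijkl\}\in\mathcal T_3}\alpha_{ijkl},\qquad \lambda(r)=\frac{\sum_{i=1}^N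 K_ir_i}{\sum_{i=1}^N r_i},$$ where the sum in $K_i$ is over the tetrahedra having $i$ as a vertex. A ball packing has constant curvature if all its $K_i$ are equal. Let $\hat r\in\mathcal M_{\mathcal T}$ have constant curvature, and define $$\chi(\hat r,\mathcal T)=\inf_{\gamma}\ \sup_{0\le t<a_\gamma}\lambda(\hat r+t\gamma),$$ where $\gamma$ ranges over the vectors of $\mathbb R^N$ with $\sum_i\gamma_i^2=1$ and $\sum_i\gamma_i=0$, and $a_\gamma$ is the least upper bound of the $a$ such that $\hat r+t\gamma\in\mathcal M_{\mathcal T}$ for all $0\le t<a$. Let $r_0\in\mathcal M_{\mathcal T}$ satisfy $\lambda(r_0)\le\chi(\hat r,\mathcal T)$. Then the normalized combinatorial Yamabe flow $$\frac{dr_i}{dt}=(\lambda-K_i)\,r_i,\qquad r(0)=r_0,$$ has a unique solution $r(t)$ in $\mathcal M_{\mathcal T}$, it exists for all $t\ge0$, and it converges exponentially fast to a constant curvature ball packing: there are a ball packing $r_\infty\in\mathcal M_{\mathcal T}$ with constant curvature and constants $C,c>0$ such that $\|r(t)-r_\infty\|\le Ce^{-ct}$ for all $t\ge0$. -/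

import Mathlib

open Set

noncomputable section

namespace BallPacking

/-- The geometric realization of a finite abstract simplicial complex `T` with vertex set `V`, in
barycentric coordinates: the points of the standard simplex whose support is a face of `T`. -/
def realization {V : Type*} [Fintype V] (T : AbstractSimplicialComplex V) : Set (V → ℝ) :=
  {x | x ∈ stdSimplex ℝ V ∧ (Finset.univ.filter fun v => x v ≠ 0) ∈ T.faces}

/-- `T` is a triangulation of the topological space `M`. -/
def Triangulates {V : Type*} [Fintype V] (T : AbstractSimplicialComplex V)
    (M : Type*) [TopologicalSpace M] : Prop :=
  Nonempty (realization T ≃ₜ M)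

/-- The angle between the sides of lengths `a` and `b` in a Euclidean triangle with side lengths
`a`, `b`, `c`. -/
def triangleAngle (a b c : ℝ) : ℝ :=
  Real.arccos ((a ^ 2 + b ^ 2 - c ^ 2) / (2 * a * b))

/-- The angle at the centre of the ball of radius `ri` in the triangle spanned by the centres of
three mutually externally tangent balls of radii `ri`, `rj`, `rk`. -/
def faceAngle (ri rj rk : ℝ) : ℝ :=
  triangleAngle (ri + rj) (ri + rk) (rj + rk)

/-- The dihedral angle at the edge `{ij}` of the Euclidean tetrahedron with vertices `i, j, k, l`
and edge lengths `ri + rj`, ..., `rk + rl`, that is, the angle between the faces `{ijk}` and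
`{ijl}`. It is the angle at `j` of the spherical triangle that the tetrahedron cuts out of the
unit sphere about `i`, whose sides are the three face angles at `i`. -/
def dihedralAngle (ri rj rk rl : ℝ) : ℝ :=
  Real.arccos
    ((Real.cos (faceAngle ri rk rl) -
        Real.cos (faceAngle ri rj rk) * Real.cos (faceAngle ri rj rl)) /
      (Real.sin (faceAngle ri rj rk) * Real.sin (faceAngle ri rj rl)))

/-- The solid angle at the vertex `i` of the Euclidean tetrahedron with vertices `i, j, k, l` and
edge lengths `ri + rj`, ..., `rk + rl`: the area of the spherical triangle that the tetrahedron
cuts out of the unit sphere about `i`, that is, the sum of its three angles (the dihedral angles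
at the three edges through `i`) minus `π`. -/
def solidAngle (ri rj rk rl : ℝ) : ℝ :=
  dihedralAngle ri rj rk rl + dihedralAngle ri rk rj rl + dihedralAngle ri rl rj rk - Real.pi

/-- The quantity `Q`; four positive radii are those of four mutually externally tangent balls
centred at the vertices of a nondegenerate Euclidean tetrahedron exactly if it is positive. -/
def descartesQ (ri rj rk rl : ℝ) : ℝ :=
  (1 / ri + 1 / rj + 1 / rk + 1 / rl) ^ 2 -
    2 * (1 / ri ^ 2 + 1 / rj ^ 2 + 1 / rk ^ 2 + 1 / rl ^ 2)

variable {V : Type*} [Fintype V] [DecidableEq V]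

/-- The set `{i, j, k, l}` is a tetrahedron of `T` (with four distinct vertices). -/
def IsTetrahedron (T : AbstractSimplicialComplex V) (i j k l : V) : Prop :=
  ({i, j, k, l} : Finset V) ∈ T.faces ∧ ({i, j, k, l} : Finset V).card = 4

/-- The space of (real) ball packings on `T`. -/
def packings (T : AbstractSimplicialComplex V) : Set (V → ℝ) :=
  {r | (∀ i, 0 < r i) ∧
    ∀ i j k l, IsTetrahedron T i j k l → 0 < descartesQ (r i) (r j) (r k) (r l)}

open Classical in
/-- The combinatorial scalar curvature at the vertex `i`: `4π` minus the sum of the solid angles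
at `i` of all tetrahedra with vertex `i`. Each such tetrahedron is `{i, j, k, l}` for six
ordered triples `(j, k, l)`, which all give the same solid angle; hence the factor `1 / 6`. -/
def curvature (T : AbstractSimplicialComplex V) (r : V → ℝ) (i : V) : ℝ :=
  4 * Real.pi - (1 / 6) * ∑ j, ∑ k, ∑ l,
    if IsTetrahedron T i j k l then solidAngle (r i) (r j) (r k) (r l) else 0

/-- The Cooper-Rivin-Glickenstein functional `λ`, the average scalar curvature. -/
def avgCurvature (T : AbstractSimplicialComplex V) (r : V → ℝ) : ℝ :=
  (∑ i, curvature T r i * r i) / ∑ i, r i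

/-- `r` is a real ball packing with constant curvature. -/
def IsConstantCurvaturePacking (T : AbstractSimplicialComplex V) (r : V → ℝ) : Prop :=
  r ∈ packings T ∧ ∃ c : ℝ, ∀ i, curvature T r i = c

/-- The least upper bound of the `a` for which `r + t γ` is a ball packing for all `0 ≤ t < a`.
It is finite for the directions `γ` of `directions V`, which have a negative coordinate. -/
def exitTime (T : AbstractSimplicialComplex V) (r γ : V → ℝ) : ℝ :=
  sSup {a : ℝ | ∀ t ∈ Ico 0 a, r + t • γ ∈ packings T}

/-- The Euclidean unit vectors whose coordinates sum to zero. -/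
def directions (V : Type*) [Fintype V] : Set (V → ℝ) :=
  {γ | ∑ i, γ i ^ 2 = 1 ∧ ∑ i, γ i = 0}

/-- The invariant `χ(r, T)`, as an extended real (so that no convention on unbounded suprema and
infima is needed). -/
def chi (T : AbstractSimplicialComplex V) (r : V → ℝ) : EReal :=
  ⨅ γ ∈ directions V, ⨆ t ∈ Ico 0 (exitTime T r γ), ((avgCurvature T (r + t • γ) : ℝ) : EReal)

/-- On the time interval `I`, the curve `r` stays in the space of ball packings and solves the
normalized combinatorial Yamabe flow `dr_i/dt = (λ - K_i) r_i`. -/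
def IsNormalizedYamabeFlowOn (T : AbstractSimplicialComplex V) (r : ℝ → V → ℝ) (I : Set ℝ) :
    Prop :=
  ∀ t ∈ I, r t ∈ packings T ∧
    ∀ i, HasDerivWithinAt (fun s => r s i)
      ((avgCurvature T (r t) - curvature T (r t) i) * r t i) I t

end BallPacking

end

/-!
Each dihedral angle of the tetrahedron spanned by four mutually tangent balls is the sum of the
angles that its two faces make with a plane through their common edge and the centre of the
midsphere. These two angles make sense for all positive radii, so the solid angles, and with them
the curvatures `K i`, extend continuously past degenerate tetrahedra. Where no tetrahedron is
degenerate, the derivative of `K` is the matrix of a positive semidefinite quadratic form, and by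
Schläfli's formula it annihilates the vector of radii. Hence `K` is the gradient of
`∑ i, K i * r i`, and this function is convex along segments that start at a ball packing.

Among radii of given sum, the convex function is minimal at `rhat`, and at a level below `chi` its
sublevel set is compact and consists of ball packings: the ray from `rhat` through a point of the
set stays in the packings until it exceeds a higher level, and by the boundedness of `K` this takes
it a definite distance further. For the same reason the second variation at `rhat` is positive
definite: a null direction would keep `K` constant. The flow, rescaled to the sum of the radii of
`rhat`, decreases the convex function, so after a short time it is trapped in such a sublevel set,
unless it starts at a minimum and is stationary. By convexity and the Cauchy–Schwarz inequality,
the distance to the minimal value is bounded by a multiple of its rate of decrease, so it decays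
exponentially, and its quadratic growth at `rhat` carries the decay over to the radii.
-/

noncomputable section

namespace BallPacking

open scoped Matrix

/-! ### The solid angle of four tangent balls -/

section Tetrahedron

variable {x y z w : ℝ}

/-- Descartes' quadratic form in the bends, that is, the reciprocal radii, of four balls. If it is
positive, then it is `4 / ρ ^ 2` for the radius `ρ` of the midsphere, the sphere tangent to all six
edges of the tetrahedron. -/
def bendQ (x y z w : ℝ) : ℝ := (x + y + z + w) ^ 2 - 2 * (x ^ 2 + y ^ 2 + z ^ 2 + w ^ 2)

/-- The reciprocal square of the inradius of the triangle spanned by the centres of three mutually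
tangent balls with bends `x`, `y`, `z`. -/
def invSqInradius (x y z : ℝ) : ℝ := x * y + y * z + x * z

/-- For four mutually tangent balls with bends `x`, `y`, `z`, `w`, the angle which the face spanned
by the first three centres makes, along any of its edges, with the plane through that edge and the
centre of the midsphere. Clamping by `arcsin` extends it continuously to all positive bends. -/
def midsphereAngle (x y z w : ℝ) : ℝ :=
  Real.arcsin ((x + y + z - w) / (2 * √(invSqInradius x y z)))

/-- The solid angle at the first of four mutually tangent balls as a function of their bends,
extended continuously to all positive bends. -/
def extSolidAngle (x y z w : ℝ) : ℝ :=
  2 * (midsphereAngle x y z w + midsphereAngle x y w z + midsphereAngle x z w y) - Real.pi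

lemma descartesQ_eq_bendQ_inv (a b c d : ℝ) : descartesQ a b c d = bendQ a⁻¹ b⁻¹ c⁻¹ d⁻¹ := by
  simp [descartesQ, bendQ]

lemma bendQ_swap₂₃ (x y z w : ℝ) : bendQ x z y w = bendQ x y z w := by unfold bendQ; ring

lemma bendQ_swap₃₄ (x y z w : ℝ) : bendQ x y w z = bendQ x y z w := by unfold bendQ; ring

lemma invSqInradius_swap₁₂ (x y z : ℝ) : invSqInradius y x z = invSqInradius x y z := by
  unfold invSqInradius; ring

lemma invSqInradius_swap₂₃ (x y z : ℝ) : invSqInradius x z y = invSqInradius x y z := by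
  unfold invSqInradius; ring

lemma midsphereAngle_swap₂₃ (x y z w : ℝ) : midsphereAngle x z y w = midsphereAngle x y z w := by
  rw [midsphereAngle, midsphereAngle, invSqInradius_swap₂₃, add_right_comm]

lemma invSqInradius_pos (hx : 0 < x) (hy : 0 < y) (hz : 0 < z) : 0 < invSqInradius x y z := by
  unfold invSqInradius; positivity

lemma one_sub_sq_div_sqrt_invSqInradius (w : ℝ) (hE : 0 < invSqInradius x y z) :
    1 - ((x + y + z - w) / (2 * √(invSqInradius x y z))) ^ 2 =
      bendQ x y z w / (2 * √(invSqInradius x y z)) ^ 2 := by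
  rw [div_pow, one_sub_div (by positivity), mul_pow, Real.sq_sqrt hE.le]
  unfold bendQ invSqInradius
  ring

lemma cos_midsphereAngle (w : ℝ) (hE : 0 < invSqInradius x y z) :
    Real.cos (midsphereAngle x y z w) = √(bendQ x y z w) / (2 * √(invSqInradius x y z)) := by
  rw [midsphereAngle, Real.cos_arcsin, one_sub_sq_div_sqrt_invSqInradius w hE,
    Real.sqrt_div' _ (by positivity), Real.sqrt_sq (by positivity)]

lemma sin_midsphereAngle (hE : 0 < invSqInradius x y z) (hQ : 0 ≤ bendQ x y z w) :
    Real.sin (midsphereAngle x y z w) = (x + y + z - w) / (2 * √(invSqInradius x y z)) := by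
  have hsq : ((x + y + z - w) / (2 * √(invSqInradius x y z))) ^ 2 ≤ 1 := by
    rw [← sub_nonneg, one_sub_sq_div_sqrt_invSqInradius w hE]
    positivity
  obtain ⟨hlower, hupper⟩ := abs_le.1 ((sq_le_one_iff_abs_le_one _).1 hsq)
  exact Real.sin_arcsin hlower hupper

lemma midsphereAngle_add_nonneg (hx : 0 < x) (hy : 0 < y) (hz : 0 < z) (hw : 0 < w)
    (hQ : 0 < bendQ x y z w) : 0 ≤ midsphereAngle x y z w + midsphereAngle x y w z := by
  have hE := invSqInradius_pos hx hy hz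
  have hE' := invSqInradius_pos hx hy hw
  have hQ' := (bendQ_swap₃₄ x y z w).symm ▸ hQ
  have hsin : 0 < Real.sin (midsphereAngle x y z w + midsphereAngle x y w z) := by
    rw [Real.sin_add, sin_midsphereAngle hE hQ.le, sin_midsphereAngle hE' hQ'.le,
      cos_midsphereAngle w hE, cos_midsphereAngle z hE', bendQ_swap₃₄ x y z w]
    calc (0 : ℝ) < 2 * (x + y) * √(bendQ x y z w) /
          (2 * √(invSqInradius x y z) * (2 * √(invSqInradius x y w))) := by positivity
      _ = _ := by field_simp; ring
  by_contra! hneg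
  have hlower := add_le_add
    (Real.neg_pi_div_two_le_arcsin ((x + y + z - w) / (2 * √(invSqInradius x y z))))
    (Real.neg_pi_div_two_le_arcsin ((x + y + w - z) / (2 * √(invSqInradius x y w))))
  rw [← neg_add, add_halves] at hlower
  exact hsin.not_ge (Real.sin_nonpos_of_nonpos_of_neg_pi_le hneg.le hlower)

lemma cos_midsphereAngle_add (hx : 0 < x) (hy : 0 < y) (hz : 0 < z) (hw : 0 < w)
    (hQ : 0 ≤ bendQ x y z w) :
    Real.cos (midsphereAngle x y z w + midsphereAngle x y w z) =
      (bendQ x y z w - (x + y + z - w) * (x + y + w - z)) /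
        (4 * (√(invSqInradius x y z) * √(invSqInradius x y w))) := by
  have hE := invSqInradius_pos hx hy hz
  have hE' := invSqInradius_pos hx hy hw
  rw [Real.cos_add, cos_midsphereAngle w hE, cos_midsphereAngle z hE', sin_midsphereAngle hE hQ,
    sin_midsphereAngle hE' ((bendQ_swap₃₄ x y z w).symm ▸ hQ), bendQ_swap₃₄ x y z w,
    div_mul_div_comm, Real.mul_self_sqrt hQ, div_mul_div_comm, ← sub_div]
  ring

end Tetrahedron

section Radii

variable {a b c d : ℝ}

lemma cos_faceAngle (ha : 0 < a) (hb : 0 < b) (hc : 0 < c) :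
    Real.cos (faceAngle a b c) = 1 - 2 * (b * c) / ((a + b) * (a + c)) := by
  have harg : ((a + b) ^ 2 + (a + c) ^ 2 - (b + c) ^ 2) / (2 * (a + b) * (a + c)) =
      1 - 2 * (b * c) / ((a + b) * (a + c)) := by
    field_simp; ring
  have hle : 2 * (b * c) / ((a + b) * (a + c)) ≤ 2 := by
    rw [div_le_iff₀ (by positivity)]
    nlinarith [mul_pos ha hb, mul_pos ha hc, mul_pos ha ha]
  have hnonneg : 0 ≤ 2 * (b * c) / ((a + b) * (a + c)) := by positivity
  rw [faceAngle, triangleAngle, harg, Real.cos_arccos (by linarith) (by linarith)]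

lemma sin_faceAngle (ha : 0 < a) (hb : 0 < b) (hc : 0 < c) :
    Real.sin (faceAngle a b c) =
      2 * (a * b * c) * √(invSqInradius a⁻¹ b⁻¹ c⁻¹) / ((a + b) * (a + c)) := by
  have hE := invSqInradius_pos (inv_pos.2 ha) (inv_pos.2 hb) (inv_pos.2 hc)
  have hsin : 0 ≤ Real.sin (faceAngle a b c) :=
    Real.sin_nonneg_of_nonneg_of_le_pi (Real.arccos_nonneg _) (Real.arccos_le_pi _)
  rw [← sq_eq_sq₀ hsin (by positivity), Real.sin_sq, cos_faceAngle ha hb hc, div_pow, mul_pow,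
    Real.sq_sqrt hE.le]
  unfold invSqInradius
  field_simp
  ring

lemma dihedralAngle_eq (ha : 0 < a) (hb : 0 < b) (hc : 0 < c) (hd : 0 < d)
    (hQ : 0 < descartesQ a b c d) :
    dihedralAngle a b c d = midsphereAngle a⁻¹ b⁻¹ c⁻¹ d⁻¹ + midsphereAngle a⁻¹ b⁻¹ d⁻¹ c⁻¹ := by
  rw [descartesQ_eq_bendQ_inv] at hQ
  have hx := inv_pos.2 ha
  have hy := inv_pos.2 hb
  have hz := inv_pos.2 hc
  have hw := inv_pos.2 hd
  have hE := Real.sqrt_pos.2 (invSqInradius_pos hx hy hz)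
  have hE' := Real.sqrt_pos.2 (invSqInradius_pos hx hy hw)
  have hle : midsphereAngle a⁻¹ b⁻¹ c⁻¹ d⁻¹ + midsphereAngle a⁻¹ b⁻¹ d⁻¹ c⁻¹ ≤ Real.pi :=
    (add_le_add (Real.arcsin_le_pi_div_two _) (Real.arcsin_le_pi_div_two _)).trans
      (add_halves Real.pi).le
  rw [dihedralAngle, ← Real.arccos_cos (midsphereAngle_add_nonneg hx hy hz hw hQ) hle,
    cos_midsphereAngle_add hx hy hz hw hQ.le, cos_faceAngle ha hc hd, cos_faceAngle ha hb hc,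
    cos_faceAngle ha hb hd, sin_faceAngle ha hb hc, sin_faceAngle ha hb hd]
  congr 1
  generalize √(invSqInradius a⁻¹ b⁻¹ c⁻¹) = e at *
  generalize √(invSqInradius a⁻¹ b⁻¹ d⁻¹) = f at *
  unfold bendQ
  field_simp
  ring

lemma solidAngle_eq_extSolidAngle (ha : 0 < a) (hb : 0 < b) (hc : 0 < c) (hd : 0 < d)
    (hQ : 0 < descartesQ a b c d) :
    solidAngle a b c d = extSolidAngle a⁻¹ b⁻¹ c⁻¹ d⁻¹ := by
  have hQ₂₃ : 0 < descartesQ a c b d := by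
    rwa [descartesQ_eq_bendQ_inv, bendQ_swap₂₃, ← descartesQ_eq_bendQ_inv]
  have hQ₂₄ : 0 < descartesQ a d b c := by
    rwa [descartesQ_eq_bendQ_inv, bendQ_swap₂₃, bendQ_swap₃₄, ← descartesQ_eq_bendQ_inv]
  rw [solidAngle, dihedralAngle_eq ha hb hc hd hQ, dihedralAngle_eq ha hc hb hd hQ₂₃,
    dihedralAngle_eq ha hd hb hc hQ₂₄, extSolidAngle, midsphereAngle_swap₂₃ a⁻¹ b⁻¹ c⁻¹ d⁻¹,
    midsphereAngle_swap₂₃ a⁻¹ b⁻¹ d⁻¹ c⁻¹, midsphereAngle_swap₂₃ a⁻¹ c⁻¹ d⁻¹ b⁻¹]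
  ring

end Radii

/-! ### The derivative of the solid angle -/

/-- The conductance of the edge between the balls with bends `x` and `y` in the weighted graph
Laplacian that gives the derivative of the solid angles of the balls with bends `x`, `y`, `z`, `w`,
up to the common factor `1 / √Q`. -/
def conductance (x y z w : ℝ) : ℝ :=
  x * y * (x * (y + z + w) + y * (x + z + w) - (z - w) ^ 2) /
    (invSqInradius x y z * invSqInradius x y w)

/-- The derivative of the solid angle at the first of four balls with bends `x`, whose radii have
the logarithmic derivatives `u`. -/
def solidAngleDeriv (x u : Fin 4 → ℝ) : ℝ :=
  1 / √(bendQ (x 0) (x 1) (x 2) (x 3)) * (x 0 *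
    (conductance (x 0) (x 1) (x 2) (x 3) * (u 1 - u 0) +
      conductance (x 0) (x 2) (x 1) (x 3) * (u 2 - u 0) +
      conductance (x 0) (x 3) (x 1) (x 2) * (u 3 - u 0)))

/-- The bilinear Dirichlet form of the conductances. -/
def dirichletForm (x u v : Fin 4 → ℝ) : ℝ :=
  conductance (x 0) (x 1) (x 2) (x 3) * ((u 1 - u 0) * (v 1 - v 0)) +
    conductance (x 0) (x 2) (x 1) (x 3) * ((u 2 - u 0) * (v 2 - v 0)) +
    conductance (x 0) (x 3) (x 1) (x 2) * ((u 3 - u 0) * (v 3 - v 0)) +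
    conductance (x 1) (x 2) (x 0) (x 3) * ((u 2 - u 1) * (v 2 - v 1)) +
    conductance (x 1) (x 3) (x 0) (x 2) * ((u 3 - u 1) * (v 3 - v 1)) +
    conductance (x 2) (x 3) (x 0) (x 1) * ((u 3 - u 2) * (v 3 - v 2))

lemma conductance_swap₁₂ (x y z w : ℝ) : conductance y x z w = conductance x y z w := by
  unfold conductance invSqInradius; ring_nf

lemma conductance_swap₃₄ (x y z w : ℝ) : conductance x y w z = conductance x y z w := by
  unfold conductance; ring_nf

section Derivative

variable {x y z w : ℝ → ℝ} {t : ℝ}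

lemma hasDerivAt_midsphereAngle {x' y' z' w' : ℝ} (hx : HasDerivAt x x' t)
    (hy : HasDerivAt y y' t) (hz : HasDerivAt z z' t) (hw : HasDerivAt w w' t)
    (hE : 0 < invSqInradius (x t) (y t) (z t)) (hQ : bendQ (x t) (y t) (z t) (w t) ≠ 0) :
    HasDerivAt (fun s => midsphereAngle (x s) (y s) (z s) (w s))
      (1 / √(bendQ (x t) (y t) (z t) (w t)) * ((x' + y' + z' - w') -
        (x t + y t + z t - w t) * (x' * (y t + z t) + y' * (x t + z t) + z' * (x t + y t)) /
          (2 * invSqInradius (x t) (y t) (z t)))) t := by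
  have hE' : HasDerivAt (fun s => invSqInradius (x s) (y s) (z s))
      (x' * (y t + z t) + y' * (x t + z t) + z' * (x t + y t)) t :=
    (((hx.mul hy).add (hy.mul hz)).add (hx.mul hz)).congr_deriv (by ring)
  have hsqrt := Real.sqrt_pos.2 hE
  have hsin : HasDerivAt
      (fun s => (x s + y s + z s - w s) / (2 * √(invSqInradius (x s) (y s) (z s)))) _ t :=
    (((hx.add hy).add hz).sub hw).div ((hE'.sqrt hE.ne').const_mul 2) (by positivity)
  have hcos := one_sub_sq_div_sqrt_invSqInradius (w t) hE
  have hne : bendQ (x t) (y t) (z t) (w t) / (2 * √(invSqInradius (x t) (y t) (z t))) ^ 2 ≠ 0 := by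
    positivity
  rw [← hcos] at hne
  refine ((Real.hasDerivAt_arcsin ?_ ?_).comp t hsin).congr_deriv ?_
  · intro h
    exact hne (by rw [h]; norm_num)
  · intro h
    exact hne (by rw [h]; norm_num)
  · rw [hcos, Real.sqrt_div' _ (by positivity), Real.sqrt_sq (by positivity), one_div_div,
      ← one_div_mul_eq_div, mul_assoc]
    congr 1
    have hsq := Real.sq_sqrt hE.le
    generalize √(invSqInradius (x t) (y t) (z t)) = e at hsq hsqrt ⊢
    simp only [← hsq, Pi.add_apply, Pi.sub_apply]
    field_simp

lemma two_mul_sum_midsphereAngle_deriv {x y z w : ℝ} (hxyz : invSqInradius x y z ≠ 0)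
    (hxyw : invSqInradius x y w ≠ 0) (hxzw : invSqInradius x z w ≠ 0) (u₀ u₁ u₂ u₃ : ℝ) :
    2 * ((-(x * u₀) + -(y * u₁) + -(z * u₂) - -(w * u₃) - (x + y + z - w) *
        (-(x * u₀) * (y + z) + -(y * u₁) * (x + z) + -(z * u₂) * (x + y)) /
          (2 * invSqInradius x y z)) +
      (-(x * u₀) + -(y * u₁) + -(w * u₃) - -(z * u₂) - (x + y + w - z) *
        (-(x * u₀) * (y + w) + -(y * u₁) * (x + w) + -(w * u₃) * (x + y)) /
          (2 * invSqInradius x y w)) +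
      (-(x * u₀) + -(z * u₂) + -(w * u₃) - -(y * u₁) - (x + z + w - y) *
        (-(x * u₀) * (z + w) + -(z * u₂) * (x + w) + -(w * u₃) * (x + z)) /
          (2 * invSqInradius x z w))) =
    x * (conductance x y z w * (u₁ - u₀) + conductance x z y w * (u₂ - u₀) +
      conductance x w y z * (u₃ - u₀)) := by
  unfold conductance
  rw [invSqInradius_swap₂₃ x y z, invSqInradius_swap₂₃ x y w, invSqInradius_swap₂₃ x z w]
  field_simp
  unfold invSqInradius
  ring

lemma hasDerivAt_extSolidAngle {u₀ u₁ u₂ u₃ : ℝ}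
    (hx : HasDerivAt x (-(x t * u₀)) t) (hy : HasDerivAt y (-(y t * u₁)) t)
    (hz : HasDerivAt z (-(z t * u₂)) t) (hw : HasDerivAt w (-(w t * u₃)) t)
    (hx₀ : 0 < x t) (hy₀ : 0 < y t) (hz₀ : 0 < z t) (hw₀ : 0 < w t)
    (hQ : bendQ (x t) (y t) (z t) (w t) ≠ 0) :
    HasDerivAt (fun s => extSolidAngle (x s) (y s) (z s) (w s))
      (solidAngleDeriv ![x t, y t, z t, w t] ![u₀, u₁, u₂, u₃]) t := by
  have hxyz := invSqInradius_pos hx₀ hy₀ hz₀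
  have hxyw := invSqInradius_pos hx₀ hy₀ hw₀
  have hxzw := invSqInradius_pos hx₀ hz₀ hw₀
  have hQ₃₄ := bendQ_swap₃₄ (x t) (y t) (z t) (w t)
  have hQ₂₄ : bendQ (x t) (z t) (w t) (y t) = bendQ (x t) (y t) (z t) (w t) := by
    rw [bendQ_swap₃₄, bendQ_swap₂₃]
  have hsum := ((hasDerivAt_midsphereAngle hx hy hz hw hxyz hQ).add
    (hasDerivAt_midsphereAngle hx hy hw hz hxyw (hQ₃₄.symm ▸ hQ))).add
    (hasDerivAt_midsphereAngle hx hz hw hy hxzw (hQ₂₄.symm ▸ hQ))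
  refine ((hsum.const_mul 2).sub_const Real.pi).congr_deriv ?_
  rw [hQ₃₄, hQ₂₄, ← mul_add, ← mul_add, mul_left_comm,
    two_mul_sum_midsphereAngle_deriv hxyz.ne' hxyw.ne' hxzw.ne']
  rfl

end Derivative

/-- In this form, the symmetry of the Dirichlet form yields both Schläfli's formula (for the radii
`y = x⁻¹`) and the convexity of the total curvature (for `y = x⁻¹ * u`). -/
lemma sum_mul_solidAngleDeriv (x y u : Fin 4 → ℝ) :
    ∑ m, y m * solidAngleDeriv (x ∘ Equiv.swap 0 m) (u ∘ Equiv.swap 0 m) =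
      -(1 / √(bendQ (x 0) (x 1) (x 2) (x 3)) * dirichletForm x (x * y) u) := by
  have hQ₁ : bendQ (x 1) (x 0) (x 2) (x 3) = bendQ (x 0) (x 1) (x 2) (x 3) := by
    unfold bendQ; ring
  have hQ₂ : bendQ (x 2) (x 1) (x 0) (x 3) = bendQ (x 0) (x 1) (x 2) (x 3) := by
    unfold bendQ; ring
  have hQ₃ : bendQ (x 3) (x 1) (x 2) (x 0) = bendQ (x 0) (x 1) (x 2) (x 3) := by
    unfold bendQ; ring
  have hedge (m n : Fin 4) := conductance_swap₁₂ (x m) (x n)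
  have hopp (m n : Fin 4) (a b : ℝ) := conductance_swap₃₄ a b (x m) (x n)
  simp only [Fin.sum_univ_four, solidAngleDeriv, dirichletForm, Function.comp_apply, Pi.mul_apply,
    Equiv.swap_apply_def, Fin.reduceEq, if_true, if_false, hQ₁, hQ₂, hQ₃, hedge 0 1, hedge 0 2,
    hedge 0 3, hedge 1 2, hedge 1 3, hedge 2 3, hopp 0 1, hopp 0 2]
  ring

/-! ### Definiteness of the Dirichlet form -/

/-- Sylvester's criterion for ternary quadratic forms. -/
lemma quadForm_pos_of_minors {A B C D E F : ℝ} (hA : 0 < A) (hm : 0 < A * D - B ^ 2)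
    (hM : 0 < A * D * F + 2 * B * C * E - A * E ^ 2 - D * C ^ 2 - F * B ^ 2) {x y z : ℝ}
    (h : ¬ (x = 0 ∧ y = 0 ∧ z = 0)) :
    0 < A * x ^ 2 + 2 * B * x * y + 2 * C * x * z + D * y ^ 2 + 2 * E * y * z + F * z ^ 2 := by
  set m := A * D - B ^ 2 with hm_def
  set M := A * D * F + 2 * B * C * E - A * E ^ 2 - D * C ^ 2 - F * B ^ 2 with hM_def
  have hsquares : A * m * (A * x ^ 2 + 2 * B * x * y + 2 * C * x * z + D * y ^ 2 +
      2 * E * y * z + F * z ^ 2) =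
      m * (A * x + B * y + C * z) ^ 2 + (m * y + (A * E - B * C) * z) ^ 2 + A * M * z ^ 2 := by
    rw [hM_def, hm_def]; ring
  rw [← mul_pos_iff_of_pos_left (mul_pos hA hm), hsquares]
  by_cases hz : z = 0
  · by_cases hy : y = 0
    · have hx : x ≠ 0 := fun hx => h ⟨hx, hy, hz⟩
      rw [hy, hz]
      simp only [mul_zero, add_zero]
      positivity
    · rw [hz]
      simp only [mul_zero, add_zero]
      positivity
  · positivity

section Conductance

variable {x y z w : ℝ}

lemma sum_conductance_pos (hx : 0 < x) (hy : 0 < y) (hz : 0 < z) (hw : 0 < w)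
    (hQ : 0 < bendQ x y z w) :
    0 < conductance x y z w + conductance x z y w + conductance x w y z := by
  have hxyz := invSqInradius_pos hx hy hz
  have hxyw := invSqInradius_pos hx hy hw
  have hxzw := invSqInradius_pos hx hz hw
  have heq : conductance x y z w + conductance x z y w + conductance x w y z =
      x * (2 * (y * z * w) * bendQ x y z w + x * ((y * z + z * w + y * w) * bendQ x y z w +
        x ^ 2 * (y * z + z * w + y * w) + y * z * w * (y + z + w) +
        x * (y ^ 2 * (z + w) + z ^ 2 * (y + w) + w ^ 2 * (y + z) + 2 * (y * z * w)))) /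
      (invSqInradius x y z * invSqInradius x y w * invSqInradius x z w) := by
    unfold conductance
    rw [invSqInradius_swap₂₃ x y z, invSqInradius_swap₂₃ x y w, invSqInradius_swap₂₃ x z w]
    field_simp
    unfold invSqInradius bendQ
    ring
  rw [heq]
  positivity

lemma conductance_minor_pos (hx : 0 < x) (hy : 0 < y) (hz : 0 < z) (hw : 0 < w)
    (hQ : 0 < bendQ x y z w) :
    0 < (conductance x y z w + conductance x z y w + conductance x w y z) *
      (conductance x y z w + conductance y z x w + conductance y w x z) -
      (-conductance x y z w) ^ 2 := by
  have hxyz := invSqInradius_pos hx hy hz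
  have hxyw := invSqInradius_pos hx hy hw
  have hxzw := invSqInradius_pos hx hz hw
  have hyzw := invSqInradius_pos hy hz hw
  have heq : (conductance x y z w + conductance x z y w + conductance x w y z) *
      (conductance x y z w + conductance y z x w + conductance y w x z) -
      (-conductance x y z w) ^ 2 =
      bendQ x y z w * (x * y * (x * y * (2 * (z ^ 2 + w ^ 2) + (z - w) ^ 2) +
        2 * (z * w) * (x + y) * (z + w) + 2 * (z * w) * (x + y) ^ 2 +
        2 * (z * w) * bendQ x y z w)) /
      (invSqInradius x y z * invSqInradius x y w * invSqInradius x z w *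
        invSqInradius y z w) := by
    unfold conductance
    rw [invSqInradius_swap₂₃ x y z, invSqInradius_swap₂₃ x y w, invSqInradius_swap₂₃ x z w,
      invSqInradius_swap₂₃ y z w, invSqInradius_swap₂₃ y x z, invSqInradius_swap₁₂ x y z,
      invSqInradius_swap₂₃ y x w, invSqInradius_swap₁₂ x y w]
    field_simp
    unfold invSqInradius bendQ
    ring
  rw [heq]
  positivity

lemma conductance_det_pos (hx : 0 < x) (hy : 0 < y) (hz : 0 < z) (hw : 0 < w)
    (hQ : 0 < bendQ x y z w) {A B C D E F : ℝ}
    (hA : A = conductance x y z w + conductance x z y w + conductance x w y z)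
    (hB : B = -conductance x y z w) (hC : C = -conductance x z y w)
    (hD : D = conductance x y z w + conductance y z x w + conductance y w x z)
    (hE : E = -conductance y z x w)
    (hF : F = conductance x z y w + conductance y z x w + conductance z w x y) :
    0 < A * D * F + 2 * B * C * E - A * E ^ 2 - D * C ^ 2 - F * B ^ 2 := by
  have hxyz := invSqInradius_pos hx hy hz
  have hxyw := invSqInradius_pos hx hy hw
  have hxzw := invSqInradius_pos hx hz hw
  have hyzw := invSqInradius_pos hy hz hw
  have heq : A * D * F + 2 * B * C * E - A * E ^ 2 - D * C ^ 2 - F * B ^ 2 =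
      6 * (x * y * z * w) * bendQ x y z w ^ 2 /
        (invSqInradius x y z * invSqInradius x y w * invSqInradius x z w *
          invSqInradius y z w) := by
    rw [hA, hB, hC, hD, hE, hF]
    unfold conductance
    rw [invSqInradius_swap₂₃ x y z, invSqInradius_swap₂₃ x y w, invSqInradius_swap₂₃ x z w,
      invSqInradius_swap₂₃ y z w, invSqInradius_swap₂₃ y x z, invSqInradius_swap₁₂ x y z,
      invSqInradius_swap₂₃ y x w, invSqInradius_swap₁₂ x y w,
      invSqInradius_swap₂₃ z x w, invSqInradius_swap₁₂ x z w, invSqInradius_swap₂₃ z y w,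
      invSqInradius_swap₁₂ y z w]
    field_simp
    unfold invSqInradius bendQ
    ring
  rw [heq]
  positivity

end Conductance

lemma dirichletForm_pos {x u : Fin 4 → ℝ} (hx : ∀ m, 0 < x m)
    (hQ : 0 < bendQ (x 0) (x 1) (x 2) (x 3)) (hu : ∃ m, u m ≠ u 3) :
    0 < dirichletForm x u u := by
  have hne : ¬ (u 0 - u 3 = 0 ∧ u 1 - u 3 = 0 ∧ u 2 - u 3 = 0) := by
    simpa [Fin.exists_fin_succ, sub_eq_zero, or_iff_not_imp_left] using hu
  have hpos := quadForm_pos_of_minors (sum_conductance_pos (hx 0) (hx 1) (hx 2) (hx 3) hQ)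
    (conductance_minor_pos (hx 0) (hx 1) (hx 2) (hx 3) hQ)
    (conductance_det_pos (hx 0) (hx 1) (hx 2) (hx 3) hQ rfl rfl rfl rfl rfl rfl) hne
  convert hpos using 1
  unfold dirichletForm
  ring

lemma dirichletForm_self_nonneg {x : Fin 4 → ℝ} (hx : ∀ m, 0 < x m)
    (hQ : 0 < bendQ (x 0) (x 1) (x 2) (x 3)) (u : Fin 4 → ℝ) : 0 ≤ dirichletForm x u u := by
  by_cases hu : ∃ m, u m ≠ u 3
  · exact (dirichletForm_pos hx hQ hu).le
  · push Not at hu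
    simp [dirichletForm, hu 0, hu 1, hu 2]

/-! ### The curvature and its derivative -/

section Tuples

variable {V : Type*}

/-- Descartes' form for the balls centred at the vertices of `q`. -/
def tupleQ (r : V → ℝ) (q : Fin 4 → V) : ℝ :=
  descartesQ (r (q 0)) (r (q 1)) (r (q 2)) (r (q 3))

lemma tupleQ_eq_bendQ (r : V → ℝ) (q : Fin 4 → V) :
    tupleQ r q = bendQ (r (q 0))⁻¹ (r (q 1))⁻¹ (r (q 2))⁻¹ (r (q 3))⁻¹ :=
  descartesQ_eq_bendQ_inv _ _ _ _

/-- The continuous extension of the solid angle at the vertex `q 0` to all positive radii `r`. -/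
def tupleAngle (r : V → ℝ) (q : Fin 4 → V) : ℝ :=
  extSolidAngle (r (q 0))⁻¹ (r (q 1))⁻¹ (r (q 2))⁻¹ (r (q 3))⁻¹

lemma hasDerivAt_tupleAngle {r : ℝ → V → ℝ} {η : V → ℝ} {t : ℝ} {q : Fin 4 → V}
    (hr : ∀ i, HasDerivAt (fun s => r s i) (η i) t) (hpos : ∀ i, 0 < r t i)
    (hQ : tupleQ (r t) q ≠ 0) :
    HasDerivAt (fun s => tupleAngle (r s) q)
      (solidAngleDeriv ((r t)⁻¹ ∘ q) (((r t)⁻¹ * η) ∘ q)) t := by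
  have hbend (i : V) : HasDerivAt (fun s => (r s i)⁻¹) (-((r t i)⁻¹ * ((r t i)⁻¹ * η i))) t := by
    refine ((hr i).inv (hpos i).ne').congr_deriv ?_
    ring
  have hinv (i : V) : 0 < (r t i)⁻¹ := inv_pos.2 (hpos i)
  rw [tupleQ_eq_bendQ] at hQ
  exact hasDerivAt_extSolidAngle (hbend _) (hbend _) (hbend _) (hbend _) (hinv _) (hinv _)
    (hinv _) (hinv _) hQ

lemma dirichletTerm_nonneg {r : V → ℝ} (hr : ∀ i, 0 < r i) (q : Fin 4 → V) (u : V → ℝ) :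
    0 ≤ 1 / √(tupleQ r q) * dirichletForm (r⁻¹ ∘ q) (u ∘ q) (u ∘ q) := by
  -- On degenerate tetrahedra the form may be indefinite, but the junk value `1 / √Q = 0` kills it.
  rcases le_or_gt (tupleQ r q) 0 with hQ | hQ
  · simp [Real.sqrt_eq_zero_of_nonpos hQ]
  · refine mul_nonneg (by positivity) (dirichletForm_self_nonneg (fun m => inv_pos.2 (hr _)) ?_ _)
    rwa [tupleQ_eq_bendQ] at hQ

end Tuples

section Curvature

variable {V : Type*} [Fintype V] [DecidableEq V]

open Classical in
/-- The tetrahedra of `T` with an ordering of their vertices. -/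
def orderedTetrahedra (T : AbstractSimplicialComplex V) : Finset (Fin 4 → V) :=
  Finset.univ.filter fun q => IsTetrahedron T (q 0) (q 1) (q 2) (q 3)

/-- The continuous extension of the combinatorial scalar curvature to all positive radii. -/
def extCurvature (T : AbstractSimplicialComplex V) (r : V → ℝ) (i : V) : ℝ :=
  4 * Real.pi - 1 / 6 * ∑ q ∈ orderedTetrahedra T with q 0 = i, tupleAngle r q

/-- The derivative of the extended curvature at `r` in the direction `η`. -/
def curvatureDeriv (T : AbstractSimplicialComplex V) (r η : V → ℝ) (i : V) : ℝ :=
  -(1 / 6 * ∑ q ∈ orderedTetrahedra T with q 0 = i, solidAngleDeriv (r⁻¹ ∘ q) ((r⁻¹ * η) ∘ q))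

variable {T : AbstractSimplicialComplex V}

lemma mem_orderedTetrahedra {q : Fin 4 → V} :
    q ∈ orderedTetrahedra T ↔ IsTetrahedron T (q 0) (q 1) (q 2) (q 3) := by
  simp [orderedTetrahedra]

lemma mem_orderedTetrahedra_iff_image {q : Fin 4 → V} :
    q ∈ orderedTetrahedra T ↔
      Finset.univ.image q ∈ T.faces ∧ (Finset.univ.image q).card = 4 := by
  have himage : Finset.univ.image q = {q 0, q 1, q 2, q 3} := by
    ext i
    simp [Fin.exists_fin_succ, eq_comm]
  rw [mem_orderedTetrahedra, IsTetrahedron, himage]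

lemma comp_perm_mem_orderedTetrahedra {q : Fin 4 → V} (hq : q ∈ orderedTetrahedra T)
    (σ : Equiv.Perm (Fin 4)) : q ∘ σ ∈ orderedTetrahedra T := by
  have himage : Finset.univ.image (q ∘ σ) = Finset.univ.image q := by
    rw [← Finset.image_image, Finset.image_univ_equiv]
  rw [mem_orderedTetrahedra_iff_image] at hq ⊢
  rwa [himage]

lemma mem_packings_iff {r : V → ℝ} :
    r ∈ packings T ↔ (∀ i, 0 < r i) ∧ ∀ q ∈ orderedTetrahedra T, 0 < tupleQ r q := by
  refine and_congr_right fun _ => ⟨fun h q hq => h _ _ _ _ (mem_orderedTetrahedra.1 hq),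
    fun h i j k l ht => ?_⟩
  have hq : ![i, j, k, l] ∈ orderedTetrahedra T := mem_orderedTetrahedra.2 ht
  exact h _ hq

open Classical in
lemma sum_orderedTetrahedra_fiber (T : AbstractSimplicialComplex V) (i : V)
    (f : (Fin 4 → V) → ℝ) :
    ∑ q ∈ orderedTetrahedra T with q 0 = i, f q =
      ∑ j, ∑ k, ∑ l, if IsTetrahedron T i j k l then f ![i, j, k, l] else 0 := by
  suffices h : ∑ q ∈ orderedTetrahedra T with q 0 = i, f q =
      ∑ p : V × V × V with IsTetrahedron T i p.1 p.2.1 p.2.2, f ![i, p.1, p.2.1, p.2.2] by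
    simpa only [Finset.sum_filter, Fintype.sum_prod_type] using h
  refine Finset.sum_nbij' (fun q => (q 1, q 2, q 3)) (fun p => ![i, p.1, p.2.1, p.2.2])
    ?_ ?_ ?_ ?_ ?_
  · intro q hq
    obtain ⟨ht, rfl⟩ := Finset.mem_filter.1 hq
    exact Finset.mem_filter.2 ⟨Finset.mem_univ _, mem_orderedTetrahedra.1 ht⟩
  · intro p hp
    exact Finset.mem_filter.2 ⟨mem_orderedTetrahedra.2 (Finset.mem_filter.1 hp).2, rfl⟩
  · intro q hq
    obtain ⟨-, rfl⟩ := Finset.mem_filter.1 hq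
    ext m
    fin_cases m <;> rfl
  · intro p _
    rfl
  · intro q hq
    obtain ⟨-, rfl⟩ := Finset.mem_filter.1 hq
    exact congrArg f (funext fun m => by fin_cases m <;> rfl)

lemma curvature_eq_extCurvature {r : V → ℝ} (hr : r ∈ packings T) :
    curvature T r = extCurvature T r := by
  funext i
  rw [curvature, extCurvature, sum_orderedTetrahedra_fiber]
  congr 2
  refine Finset.sum_congr rfl fun j _ => Finset.sum_congr rfl fun k _ =>
    Finset.sum_congr rfl fun l _ => ?_
  split_ifs with ht
  · exact solidAngle_eq_extSolidAngle (hr.1 i) (hr.1 j) (hr.1 k) (hr.1 l) (hr.2 i j k l ht)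
  · rfl

lemma hasDerivAt_extCurvature {r : ℝ → V → ℝ} {η : V → ℝ} {t : ℝ} (hr : HasDerivAt r η t)
    (hpos : ∀ i, 0 < r t i) (hQ : ∀ q ∈ orderedTetrahedra T, tupleQ (r t) q ≠ 0) :
    HasDerivAt (fun s => extCurvature T (r s)) (curvatureDeriv T (r t) η) t := by
  refine hasDerivAt_pi.2 fun i => ((HasDerivAt.fun_sum fun q hq => ?_).const_mul _).const_sub _
  exact hasDerivAt_tupleAngle (hasDerivAt_pi.1 hr) hpos (hQ q (Finset.mem_filter.1 hq).1)

lemma dotProduct_sum_orderedTetrahedra (T : AbstractSimplicialComplex V) (y : V → ℝ)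
    (f : (Fin 4 → V) → ℝ) :
    (y ⬝ᵥ fun i => ∑ q ∈ orderedTetrahedra T with q 0 = i, f q) =
      1 / 4 * ∑ q ∈ orderedTetrahedra T, ∑ m, y (q m) * f (q ∘ Equiv.swap 0 m) := by
  have hfiber : (y ⬝ᵥ fun i => ∑ q ∈ orderedTetrahedra T with q 0 = i, f q) =
      ∑ q ∈ orderedTetrahedra T, y (q 0) * f q := by
    rw [dotProduct, ← Finset.sum_fiberwise (orderedTetrahedra T) (fun q => q 0)]
    refine Finset.sum_congr rfl fun i _ => ?_
    rw [Finset.mul_sum]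
    exact Finset.sum_congr rfl fun q hq => by rw [(Finset.mem_filter.1 hq).2]
  have hswap (m : Fin 4) : ∑ q ∈ orderedTetrahedra T, y (q m) * f (q ∘ Equiv.swap 0 m) =
      ∑ q ∈ orderedTetrahedra T, y (q 0) * f q := by
    refine Finset.sum_nbij' (· ∘ Equiv.swap 0 m) (· ∘ Equiv.swap 0 m)
      (fun q hq => comp_perm_mem_orderedTetrahedra hq _)
      (fun q hq => comp_perm_mem_orderedTetrahedra hq _) ?_ ?_ ?_ <;> intro q _
    · ext; simp
    · ext; simp
    · simp
  rw [hfiber, Finset.sum_comm]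
  simp only [hswap, Finset.sum_const, Finset.card_univ, Fintype.card_fin, nsmul_eq_mul]
  ring

lemma dotProduct_curvatureDeriv (T : AbstractSimplicialComplex V) (r y η : V → ℝ) :
    y ⬝ᵥ curvatureDeriv T r η = 1 / 24 * ∑ q ∈ orderedTetrahedra T,
      1 / √(tupleQ r q) * dirichletForm (r⁻¹ ∘ q) ((r⁻¹ * y) ∘ q) ((r⁻¹ * η) ∘ q) := by
  have hsmul : curvatureDeriv T r η = (-(1 / 6 : ℝ)) • fun i =>
      ∑ q ∈ orderedTetrahedra T with q 0 = i, solidAngleDeriv (r⁻¹ ∘ q) ((r⁻¹ * η) ∘ q) := by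
    funext i
    simp [curvatureDeriv]
  rw [hsmul, dotProduct_smul, dotProduct_sum_orderedTetrahedra]
  have hform (q : Fin 4 → V) : ∑ m, y (q m) * solidAngleDeriv (r⁻¹ ∘ q ∘ Equiv.swap 0 m)
      ((r⁻¹ * η) ∘ q ∘ Equiv.swap 0 m) =
      -(1 / √(tupleQ r q) * dirichletForm (r⁻¹ ∘ q) ((r⁻¹ * y) ∘ q) ((r⁻¹ * η) ∘ q)) := by
    rw [tupleQ_eq_bendQ]
    exact sum_mul_solidAngleDeriv (r⁻¹ ∘ q) (y ∘ q) ((r⁻¹ * η) ∘ q)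
  simp only [hform, Finset.sum_neg_distrib, smul_eq_mul]
  ring

/-- Schläfli's formula. -/
lemma dotProduct_curvatureDeriv_self {r : V → ℝ} (hr : ∀ i, r i ≠ 0) (η : V → ℝ) :
    r ⬝ᵥ curvatureDeriv T r η = 0 := by
  have hone : r⁻¹ * r = 1 := funext fun i => inv_mul_cancel₀ (hr i)
  simp [dotProduct_curvatureDeriv, hone, dirichletForm]

lemma dotProduct_curvatureDeriv_nonneg {r : V → ℝ} (hr : ∀ i, 0 < r i) (η : V → ℝ) :
    0 ≤ η ⬝ᵥ curvatureDeriv T r η := by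
  rw [dotProduct_curvatureDeriv]
  exact mul_nonneg (by norm_num) (Finset.sum_nonneg fun q _ => dirichletTerm_nonneg hr q _)

lemma div_eq_div_of_dotProduct_curvatureDeriv_eq_zero {r η : V → ℝ} (hr : r ∈ packings T)
    (hη : η ⬝ᵥ curvatureDeriv T r η = 0) {q : Fin 4 → V} (hq : q ∈ orderedTetrahedra T)
    (m : Fin 4) : (r (q m))⁻¹ * η (q m) = (r (q 3))⁻¹ * η (q 3) := by
  rw [dotProduct_curvatureDeriv] at hη
  have hsum := (mul_eq_zero.1 hη).resolve_left (by norm_num)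
  have hterm := (Finset.sum_eq_zero_iff_of_nonneg fun q _ => dirichletTerm_nonneg hr.1 q _).1
    hsum q hq
  have hQ := (mem_packings_iff.1 hr).2 q hq
  have hform := (mul_eq_zero.1 hterm).resolve_left (by positivity)
  by_contra hne
  rw [tupleQ_eq_bendQ] at hQ
  exact (dirichletForm_pos (u := (r⁻¹ * η) ∘ q) (fun m => inv_pos.2 (hr.1 _)) hQ ⟨m, hne⟩).ne'
    hform

end Curvature

/-! ### Regularity of the curvature -/

section Regularity

open scoped Topology

lemma continuousAt_midsphereAngle {X : Type*} [TopologicalSpace X] {x y z w : X → ℝ} {p : X}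
    (hx : ContinuousAt x p) (hy : ContinuousAt y p) (hz : ContinuousAt z p)
    (hw : ContinuousAt w p) (hE : 0 < invSqInradius (x p) (y p) (z p)) :
    ContinuousAt (fun s => midsphereAngle (x s) (y s) (z s) (w s)) p := by
  have hE' : ContinuousAt (fun s => invSqInradius (x s) (y s) (z s)) p :=
    ((hx.mul hy).add (hy.mul hz)).add (hx.mul hz)
  exact Real.continuous_arcsin.continuousAt.comp ((((hx.add hy).add hz).sub hw).div
    (continuousAt_const.mul hE'.sqrt) (by positivity))

lemma contDiffAt_midsphereAngle {E : Type*} [NormedAddCommGroup E] [NormedSpace ℝ E]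
    {x y z w : E → ℝ} {p : E} {n : WithTop ℕ∞} (hx : ContDiffAt ℝ n x p) (hy : ContDiffAt ℝ n y p)
    (hz : ContDiffAt ℝ n z p) (hw : ContDiffAt ℝ n w p)
    (hE : 0 < invSqInradius (x p) (y p) (z p)) (hQ : bendQ (x p) (y p) (z p) (w p) ≠ 0) :
    ContDiffAt ℝ n (fun s => midsphereAngle (x s) (y s) (z s) (w s)) p := by
  have hE' : ContDiffAt ℝ n (fun s => invSqInradius (x s) (y s) (z s)) p :=
    ((hx.mul hy).add (hy.mul hz)).add (hx.mul hz)
  have hsq := one_sub_sq_div_sqrt_invSqInradius (w p) hE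
  have hne : bendQ (x p) (y p) (z p) (w p) / (2 * √(invSqInradius (x p) (y p) (z p))) ^ 2 ≠ 0 := by
    positivity
  rw [← hsq] at hne
  refine ContDiffAt.comp p (Real.contDiffAt_arcsin ?_ ?_) ((((hx.add hy).add hz).sub hw).div
    (contDiffAt_const.mul (hE'.sqrt hE.ne')) (by positivity)) <;>
  · intro h
    exact hne (by rw [h]; norm_num)

lemma abs_extSolidAngle_le (x y z w : ℝ) : |extSolidAngle x y z w| ≤ 4 * Real.pi := by
  have hlower (a : ℝ) := Real.neg_pi_div_two_le_arcsin a
  have hupper (a : ℝ) := Real.arcsin_le_pi_div_two a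
  rw [abs_le]
  unfold extSolidAngle midsphereAngle
  constructor
  · linarith [hlower ((x + y + z - w) / (2 * √(invSqInradius x y z))),
      hlower ((x + y + w - z) / (2 * √(invSqInradius x y w))),
      hlower ((x + z + w - y) / (2 * √(invSqInradius x z w)))]
  · linarith [hupper ((x + y + z - w) / (2 * √(invSqInradius x y z))),
      hupper ((x + y + w - z) / (2 * √(invSqInradius x y w))),
      hupper ((x + z + w - y) / (2 * √(invSqInradius x z w))), Real.pi_pos]

lemma midsphereAngle_smul {c : ℝ} (hc : 0 < c) (x y z w : ℝ) :
    midsphereAngle (c * x) (c * y) (c * z) (c * w) = midsphereAngle x y z w := by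
  have hE : invSqInradius (c * x) (c * y) (c * z) = c ^ 2 * invSqInradius x y z := by
    unfold invSqInradius; ring
  rw [midsphereAngle, hE, Real.sqrt_mul (by positivity), Real.sqrt_sq hc.le, mul_left_comm,
    ← mul_add, ← mul_add, ← mul_sub, mul_div_mul_left _ _ hc.ne', midsphereAngle]

lemma hasDerivAt_add_smul {E : Type*} [NormedAddCommGroup E] [NormedSpace ℝ E] (x v : E) (t : ℝ) :
    HasDerivAt (fun s : ℝ => x + s • v) v t := by
  simpa using ((hasDerivAt_id t).smul_const v).const_add x

variable {V : Type*}

lemma tupleAngle_congr {r p : V → ℝ} {q : Fin 4 → V} {c : ℝ} (hc : 0 < c)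
    (h : ∀ m, p (q m) = c * r (q m)) : tupleAngle p q = tupleAngle r q := by
  simp only [tupleAngle, extSolidAngle, h, mul_inv, midsphereAngle_smul (inv_pos.2 hc)]

lemma continuousAt_tupleAngle {r : V → ℝ} (hr : ∀ i, 0 < r i) (q : Fin 4 → V) :
    ContinuousAt (fun p => tupleAngle p q) r := by
  have hbend (i : V) : ContinuousAt (fun p : V → ℝ => (p i)⁻¹) r :=
    (continuous_apply i).continuousAt.inv₀ (hr i).ne'
  have hangle (a b c d : V) := continuousAt_midsphereAngle (hbend a) (hbend b) (hbend c) (hbend d)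
    (invSqInradius_pos (inv_pos.2 (hr a)) (inv_pos.2 (hr b)) (inv_pos.2 (hr c)))
  exact (continuousAt_const.mul (((hangle _ _ _ _).add (hangle _ _ _ _)).add
    (hangle _ _ _ _))).sub continuousAt_const

lemma contDiffAt_tupleAngle [Fintype V] {r : V → ℝ} (hr : ∀ i, 0 < r i) {q : Fin 4 → V}
    (hQ : tupleQ r q ≠ 0) {n : WithTop ℕ∞} : ContDiffAt ℝ n (fun p => tupleAngle p q) r := by
  have hbend (i : V) : ContDiffAt ℝ n (fun p : V → ℝ => (p i)⁻¹) r :=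
    (contDiffAt_apply ℝ ℝ i r).inv (hr i).ne'
  have hangle (a b c d : V) := contDiffAt_midsphereAngle (hbend a) (hbend b) (hbend c) (hbend d)
    (invSqInradius_pos (inv_pos.2 (hr a)) (inv_pos.2 (hr b)) (inv_pos.2 (hr c)))
  rw [tupleQ_eq_bendQ] at hQ
  refine (contDiffAt_const.mul (((hangle _ _ _ _ hQ).add (hangle _ _ _ _ ?_)).add
    (hangle _ _ _ _ ?_))).sub contDiffAt_const
  · rwa [bendQ_swap₃₄]
  · rwa [bendQ_swap₃₄, bendQ_swap₂₃]

lemma continuousAt_tupleQ {r : V → ℝ} (hr : ∀ i, 0 < r i) (q : Fin 4 → V) :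
    ContinuousAt (fun p => tupleQ p q) r := by
  have hbend (i : V) : ContinuousAt (fun p : V → ℝ => (p i)⁻¹) r :=
    (continuous_apply i).continuousAt.inv₀ (hr i).ne'
  simp only [tupleQ_eq_bendQ, bendQ]
  fun_prop

lemma smul_mem_packings [DecidableEq V] {T : AbstractSimplicialComplex V} {r : V → ℝ}
    (hr : r ∈ packings T) {c : ℝ} (hc : 0 < c) : c • r ∈ packings T := by
  refine ⟨fun i => mul_pos hc (hr.1 i), fun i j k l hT => ?_⟩
  have hscale : descartesQ ((c • r) i) ((c • r) j) ((c • r) k) ((c • r) l) =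
      c⁻¹ ^ 2 * descartesQ (r i) (r j) (r k) (r l) := by
    simp only [descartesQ_eq_bendQ_inv, bendQ, Pi.smul_apply, smul_eq_mul, mul_inv]
    ring
  rw [hscale]
  exact mul_pos (by positivity) (hr.2 i j k l hT)

lemma isOpen_packings [Finite V] [DecidableEq V] (T : AbstractSimplicialComplex V) :
    IsOpen (packings T) := by
  cases nonempty_fintype V
  rw [isOpen_iff_mem_nhds]
  intro r hr
  have hpos : ∀ᶠ p in 𝓝 r, ∀ i, 0 < p i := Filter.eventually_all.2 fun i =>
    (continuous_apply i).continuousAt.eventually_const_lt (hr.1 i)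
  have hQ : ∀ᶠ p in 𝓝 r, ∀ q ∈ orderedTetrahedra T, 0 < tupleQ p q :=
    (Filter.eventually_all_finset _).2 fun q hq =>
      (continuousAt_tupleQ hr.1 q).eventually_const_lt ((mem_packings_iff.1 hr).2 q hq)
  filter_upwards [hpos, hQ] with p hpos hQ using mem_packings_iff.2 ⟨hpos, hQ⟩

variable [Fintype V] [DecidableEq V] {T : AbstractSimplicialComplex V}

lemma continuousAt_extCurvature {r : V → ℝ} (hr : ∀ i, 0 < r i) :
    ContinuousAt (extCurvature T) r :=
  continuousAt_pi.2 fun _ => continuousAt_const.sub (continuousAt_const.mul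
    (tendsto_finsetSum _ fun q _ => continuousAt_tupleAngle hr q))

lemma contDiffAt_extCurvature {r : V → ℝ} (hr : r ∈ packings T) {n : WithTop ℕ∞} :
    ContDiffAt ℝ n (extCurvature T) r := by
  refine contDiffAt_pi.2 fun i => contDiffAt_const.sub (contDiffAt_const.mul
    (ContDiffAt.sum fun q hq => contDiffAt_tupleAngle hr.1 ?_))
  exact ((mem_packings_iff.1 hr).2 q (Finset.mem_filter.1 hq).1).ne'

lemma fderiv_extCurvature {r : V → ℝ} (hr : r ∈ packings T) (η : V → ℝ) :
    fderiv ℝ (extCurvature T) r η = curvatureDeriv T r η := by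
  have hr₀ : r + (0 : ℝ) • η = r := by simp
  have hcont : ContDiffAt ℝ 1 (extCurvature T) r := contDiffAt_extCurvature hr
  have hfderiv : HasFDerivAt (extCurvature T) (fderiv ℝ (extCurvature T) r)
      (r + (0 : ℝ) • η) := by
    rw [hr₀]
    exact (hcont.differentiableAt one_ne_zero).hasFDerivAt
  have hpacking := mem_packings_iff.1 hr
  have hderiv := hasDerivAt_extCurvature (T := T) (hasDerivAt_add_smul r η 0)
    (hr₀.symm ▸ hpacking.1) (hr₀.symm ▸ fun q hq => (hpacking.2 q hq).ne')
  rw [hr₀] at hderiv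
  have hchain := hfderiv.comp_hasDerivAt 0 (hasDerivAt_add_smul r η 0)
  exact hchain.unique hderiv

lemma exists_norm_extCurvature_le (T : AbstractSimplicialComplex V) :
    ∃ B : ℝ, ∀ r, ‖extCurvature T r‖ ≤ B := by
  refine ⟨4 * Real.pi + 1 / 6 * ∑ _q ∈ orderedTetrahedra T, 4 * Real.pi, fun r => ?_⟩
  refine (pi_norm_le_iff_of_nonneg (by positivity)).2 fun i => (norm_sub_le _ _).trans ?_
  rw [Real.norm_of_nonneg (by positivity : 0 ≤ 4 * Real.pi), norm_mul,
    Real.norm_of_nonneg (by norm_num : (0 : ℝ) ≤ 1 / 6)]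
  gcongr
  refine (norm_sum_le_of_le _ fun q _ => abs_extSolidAngle_le _ _ _ _).trans ?_
  exact Finset.sum_le_sum_of_subset_of_nonneg (Finset.filter_subset _ _)
    fun _ _ _ => by positivity

lemma extCurvature_congr {r p : V → ℝ} {i : V}
    (h : ∀ q ∈ orderedTetrahedra T, q 0 = i → ∃ c > 0, ∀ m, p (q m) = c * r (q m)) :
    extCurvature T p i = extCurvature T r i := by
  unfold extCurvature
  congr 2
  refine Finset.sum_congr rfl fun q hq => ?_
  obtain ⟨hq, hi⟩ := Finset.mem_filter.1 hq
  obtain ⟨c, hc, hscale⟩ := h q hq hi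
  exact tupleAngle_congr hc hscale

lemma extCurvature_smul (r : V → ℝ) {c : ℝ} (hc : 0 < c) :
    extCurvature T (c • r) = extCurvature T r :=
  funext fun _ => extCurvature_congr fun _ _ _ => ⟨c, hc, fun _ => rfl⟩

end Regularity

/-! ### Convexity of the total curvature along segments -/

section FiniteExceptions

lemma monotoneOn_of_hasDerivAt_nonneg_off_finite {f : ℝ → ℝ} {Z : Set ℝ} (hZ : Z.Finite)
    {a b : ℝ} (hf : ContinuousOn f (Icc a b))
    (hf' : ∀ t ∈ Ioo a b \ Z, ∃ f' ≥ 0, HasDerivAt f f' t) : MonotoneOn f (Icc a b) := by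
  induction Z, hZ using Set.Finite.induction_on generalizing a b with
  | empty =>
    rw [sdiff_empty] at hf'
    refine monotoneOn_of_deriv_nonneg (convex_Icc a b) hf ?_ ?_ <;> rw [interior_Icc] <;>
      intro t ht <;> obtain ⟨f', hnonneg, hderiv⟩ := hf' t ht
    · exact hderiv.differentiableAt.differentiableWithinAt
    · rwa [hderiv.deriv]
  | @insert z Z _ _ ih =>
    by_cases hz : z ∈ Ioo a b
    · have hleft : MonotoneOn f (Icc a z) := ih (hf.mono (Icc_subset_Icc_right hz.2.le))
        fun t ht => hf' t ⟨⟨ht.1.1, ht.1.2.trans hz.2⟩, by simp [ht.1.2.ne, ht.2]⟩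
      have hright : MonotoneOn f (Icc z b) := ih (hf.mono (Icc_subset_Icc_left hz.1.le))
        fun t ht => hf' t ⟨⟨hz.1.trans ht.1.1, ht.1.2⟩, by simp [ht.1.1.ne', ht.2]⟩
      rw [← Icc_union_Icc_eq_Icc hz.1.le hz.2.le]
      exact hleft.union_right hright (isGreatest_Icc hz.1.le) (isLeast_Icc hz.2.le)
    · refine ih hf fun t ht => hf' t ⟨ht.1, ?_⟩
      rintro (rfl | h)
      exacts [hz ht.1, ht.2 h]

/-- Descartes' form in the radii multiplied by their squared product, which makes it a
polynomial. -/
def clearedQ {R : Type*} [CommRing R] (a b c d : R) : R :=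
  (b * c * d + a * c * d + a * b * d + a * b * c) ^ 2 -
    2 * ((b * c * d) ^ 2 + (a * c * d) ^ 2 + (a * b * d) ^ 2 + (a * b * c) ^ 2)

lemma map_clearedQ {R S : Type*} [CommRing R] [CommRing S] (f : R →+* S) (a b c d : R) :
    f (clearedQ a b c d) = clearedQ (f a) (f b) (f c) (f d) := by
  simp [clearedQ, map_ofNat]

lemma clearedQ_eq {a b c d : ℝ} (ha : a ≠ 0) (hb : b ≠ 0) (hc : c ≠ 0) (hd : d ≠ 0) :
    clearedQ a b c d = (a * b * c * d) ^ 2 * descartesQ a b c d := by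
  unfold clearedQ descartesQ
  field_simp

variable {V : Type*}

lemma finite_setOf_tupleQ_add_smul_eq_zero {r : V → ℝ} (hr : ∀ i, r i ≠ 0) {q : Fin 4 → V}
    (hQ : tupleQ r q ≠ 0) (η : V → ℝ) :
    {t : ℝ | (∀ i, (r + t • η) i ≠ 0) ∧ tupleQ (r + t • η) q = 0}.Finite := by
  let radius (i : V) : Polynomial ℝ := .C (r i) + .C (η i) * .X
  let P := clearedQ (radius (q 0)) (radius (q 1)) (radius (q 2)) (radius (q 3))
  have hP {t : ℝ} (ht : ∀ i, (r + t • η) i ≠ 0) : P.eval t =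
      ((r + t • η) (q 0) * (r + t • η) (q 1) * (r + t • η) (q 2) * (r + t • η) (q 3)) ^ 2 *
        tupleQ (r + t • η) q := by
    have hradius (i : V) : Polynomial.evalRingHom t (radius i) = (r + t • η) i := by
      simp [radius, mul_comm t]
    rw [← Polynomial.coe_evalRingHom, map_clearedQ]
    simp only [hradius]
    exact clearedQ_eq (ht _) (ht _) (ht _) (ht _)
  have hP₀ : P ≠ 0 := by
    intro hzero
    have heval := hP (t := 0) (by simpa using hr)
    simp only [hzero, zero_smul, add_zero, Polynomial.eval_zero] at heval
    exact mul_ne_zero (pow_ne_zero 2 (by simp [hr])) hQ heval.symm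
  refine (Polynomial.finite_setOfPred_isRoot hP₀).subset fun t ht => ?_
  rw [mem_ofPred_eq, Polynomial.IsRoot, hP ht.1, ht.2, mul_zero]

lemma add_smul_pos {r η : V → ℝ} {τ : ℝ} (hr : ∀ i, 0 < r i) (hτ : ∀ i, 0 < (r + τ • η) i)
    {t : ℝ} (ht : t ∈ Icc 0 τ) (i : V) : 0 < (r + t • η) i := by
  have hri := hr i
  have hτi := hτ i
  simp only [Pi.add_apply, Pi.smul_apply, smul_eq_mul] at hτi ⊢
  rcases le_or_gt 0 (η i) with hη | hη
  · nlinarith [mul_nonneg ht.1 hη]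
  · nlinarith [mul_le_mul_of_nonpos_right ht.2 hη.le]

end FiniteExceptions

section Total

variable {V : Type*} [Fintype V] [DecidableEq V] {T : AbstractSimplicialComplex V}

/-- The total curvature `∑ i, K i * r i` for the extended curvature. -/
def totalCurvature (T : AbstractSimplicialComplex V) (r : V → ℝ) : ℝ := extCurvature T r ⬝ᵥ r

lemma avgCurvature_eq {r : V → ℝ} (hr : r ∈ packings T) :
    avgCurvature T r = totalCurvature T r / ∑ i, r i := by
  rw [avgCurvature, curvature_eq_extCurvature hr]
  rfl

lemma continuousAt_totalCurvature {r : V → ℝ} (hr : ∀ i, 0 < r i) :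
    ContinuousAt (totalCurvature T) r :=
  tendsto_finsetSum _ fun i _ =>
    (continuousAt_pi.1 (continuousAt_extCurvature hr) i).mul (continuous_apply i).continuousAt

/-- By Schläfli's formula, the derivative of the curvature does not contribute. -/
lemma hasDerivAt_totalCurvature {r : ℝ → V → ℝ} {η : V → ℝ} {t : ℝ} (hr : HasDerivAt r η t)
    (hpos : ∀ i, 0 < r t i) (hQ : ∀ q ∈ orderedTetrahedra T, tupleQ (r t) q ≠ 0) :
    HasDerivAt (fun s => totalCurvature T (r s)) (extCurvature T (r t) ⬝ᵥ η) t := by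
  refine (HasDerivAt.fun_sum fun i _ => (hasDerivAt_pi.1 (hasDerivAt_extCurvature hr hpos hQ)
    i).mul (hasDerivAt_pi.1 hr i)).congr_deriv ?_
  rw [Finset.sum_add_distrib]
  have hschlaefli := dotProduct_curvatureDeriv_self (T := T) (fun i => (hpos i).ne') η
  rw [dotProduct_comm] at hschlaefli
  exact add_eq_right.2 hschlaefli

lemma finite_setOf_degenerate_add_smul {r : V → ℝ} (hr : r ∈ packings T) (η : V → ℝ) :
    {t : ℝ | (∀ i, 0 < (r + t • η) i) ∧
      ∃ q ∈ orderedTetrahedra T, tupleQ (r + t • η) q = 0}.Finite := by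
  rw [mem_packings_iff] at hr
  refine ((orderedTetrahedra T).finite_toSet.biUnion fun q hq =>
    finite_setOf_tupleQ_add_smul_eq_zero (fun i => (hr.1 i).ne') (hr.2 q hq).ne' η).subset ?_
  rintro t ⟨hpos, q, hq, hzero⟩
  exact mem_biUnion (x := q) hq ⟨fun i => (hpos i).ne', hzero⟩

variable {r η : V → ℝ} {τ : ℝ}

lemma monotoneOn_of_hasDerivAt_nonneg_off_degenerate (hr : r ∈ packings T)
    (hτ : ∀ i, 0 < (r + τ • η) i) {f : ℝ → ℝ} {a b : ℝ} (ha : 0 ≤ a) (hb : b ≤ τ)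
    (hf : ∀ t ∈ Icc a b, ContinuousAt f t)
    (hf' : ∀ t ∈ Ioo a b, (∀ i, 0 < (r + t • η) i) →
      (∀ q ∈ orderedTetrahedra T, tupleQ (r + t • η) q ≠ 0) → ∃ f' ≥ 0, HasDerivAt f f' t) :
    MonotoneOn f (Icc a b) := by
  refine monotoneOn_of_hasDerivAt_nonneg_off_finite (finite_setOf_degenerate_add_smul hr η)
    (fun t ht => (hf t ht).continuousWithinAt) fun t ht => ?_
  have hpos := add_smul_pos hr.1 hτ ⟨ha.trans ht.1.1.le, ht.1.2.le.trans hb⟩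
  exact hf' t ht.1 hpos fun q hq hzero => ht.2 ⟨hpos, q, hq, hzero⟩

lemma monotoneOn_extCurvature_dotProduct (hr : r ∈ packings T) (hτ : ∀ i, 0 < (r + τ • η) i) :
    MonotoneOn (fun t : ℝ => extCurvature T (r + t • η) ⬝ᵥ η) (Icc 0 τ) := by
  refine monotoneOn_of_hasDerivAt_nonneg_off_degenerate hr hτ le_rfl le_rfl (fun t ht => ?_)
    fun t _ hpos hQ => ⟨_, dotProduct_curvatureDeriv_nonneg (T := T) hpos η, ?_⟩
  · have hcont : ContinuousAt (fun t : ℝ => extCurvature T (r + t • η)) t :=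
      (continuousAt_extCurvature (add_smul_pos hr.1 hτ ht)).comp
        (f := fun t : ℝ => r + t • η) (by fun_prop)
    exact tendsto_finsetSum _ fun i _ => (continuousAt_pi.1 hcont i).mul continuousAt_const
  · rw [dotProduct_comm]
    exact HasDerivAt.fun_sum fun i _ => (hasDerivAt_pi.1
      (hasDerivAt_extCurvature (hasDerivAt_add_smul r η t) hpos hQ) i).mul_const _

lemma continuousAt_totalCurvature_add_smul {t : ℝ} (ht : ∀ i, 0 < (r + t • η) i) :
    ContinuousAt (fun t : ℝ => totalCurvature T (r + t • η)) t :=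
  (continuousAt_totalCurvature ht).comp (f := fun t : ℝ => r + t • η) (by fun_prop)

lemma mul_le_totalCurvature_sub (hr : r ∈ packings T) (hτ : ∀ i, 0 < (r + τ • η) i) {s t : ℝ}
    (hs : 0 ≤ s) (hst : s ≤ t) (ht : t ≤ τ) :
    (t - s) * (extCurvature T (r + s • η) ⬝ᵥ η) ≤
      totalCurvature T (r + t • η) - totalCurvature T (r + s • η) := by
  have hmono : MonotoneOn (fun u : ℝ => totalCurvature T (r + u • η) -
      u * (extCurvature T (r + s • η) ⬝ᵥ η)) (Icc s t) := by
    refine monotoneOn_of_hasDerivAt_nonneg_off_degenerate hr hτ hs ht (fun u hu => ?_)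
      fun u hu hpos hQ => ⟨_, ?_, (hasDerivAt_totalCurvature (hasDerivAt_add_smul r η u) hpos
        hQ).sub ((hasDerivAt_id u).mul_const _)⟩
    · exact (continuousAt_totalCurvature_add_smul
        (add_smul_pos hr.1 hτ ⟨hs.trans hu.1, hu.2.trans ht⟩)).sub (by fun_prop)
    · rw [one_mul]
      exact sub_nonneg.2 (monotoneOn_extCurvature_dotProduct hr hτ ⟨hs, hst.trans ht⟩
        ⟨hs.trans hu.1.le, hu.2.le.trans ht⟩ hu.1.le)
  linarith [hmono (left_mem_Icc.2 hst) (right_mem_Icc.2 hst) hst]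

lemma totalCurvature_sub_le_mul (hr : r ∈ packings T) (hτ : ∀ i, 0 < (r + τ • η) i) {s t : ℝ}
    (hs : 0 ≤ s) (hst : s ≤ t) (ht : t ≤ τ) :
    totalCurvature T (r + t • η) - totalCurvature T (r + s • η) ≤
      (t - s) * (extCurvature T (r + t • η) ⬝ᵥ η) := by
  have hmono : MonotoneOn (fun u : ℝ => u * (extCurvature T (r + t • η) ⬝ᵥ η) -
      totalCurvature T (r + u • η)) (Icc s t) := by
    refine monotoneOn_of_hasDerivAt_nonneg_off_degenerate hr hτ hs ht (fun u hu => ?_)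
      fun u hu hpos hQ => ⟨_, ?_, ((hasDerivAt_id u).mul_const _).sub
        (hasDerivAt_totalCurvature (hasDerivAt_add_smul r η u) hpos hQ)⟩
    · exact ContinuousAt.sub (by fun_prop) (continuousAt_totalCurvature_add_smul
        (add_smul_pos hr.1 hτ ⟨hs.trans hu.1, hu.2.trans ht⟩))
    · rw [one_mul]
      exact sub_nonneg.2 (monotoneOn_extCurvature_dotProduct hr hτ
        ⟨hs.trans hu.1.le, hu.2.le.trans ht⟩ ⟨hs.trans hst, ht⟩ hu.2.le)
  linarith [hmono (left_mem_Icc.2 hst) (right_mem_Icc.2 hst) hst]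

end Total

/-! ### Comparison with a packing of constant curvature -/

section Norms

lemma abs_dotProduct_le {ι : Type*} [Fintype ι] (x y : ι → ℝ) :
    |x ⬝ᵥ y| ≤ Fintype.card ι * (‖x‖ * ‖y‖) := by
  refine (norm_sum_le_of_le _ fun i _ => (norm_mul_le _ _).trans
    (mul_le_mul (norm_le_pi_norm x i) (norm_le_pi_norm y i) (norm_nonneg _)
      (norm_nonneg _))).trans_eq ?_
  rw [Finset.sum_const, Finset.card_univ, nsmul_eq_mul]

lemma exists_mul_norm_sq_le {E : Type*} [NormedAddCommGroup E] [NormedSpace ℝ E]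
    [FiniteDimensional ℝ E] {f : E → ℝ} (hf : Continuous f)
    (hsmul : ∀ (c : ℝ) x, f (c • x) = c ^ 2 * f x) {W : Submodule ℝ E}
    (hpos : ∀ x ∈ W, x ≠ 0 → 0 < f x) : ∃ m > 0, ∀ x ∈ W, m * ‖x‖ ^ 2 ≤ f x := by
  have : ProperSpace E := FiniteDimensional.proper_real E
  have hcompact : IsCompact (Metric.sphere (0 : E) 1 ∩ W) :=
    (isCompact_sphere 0 1).inter_right W.closed_of_finiteDimensional
  obtain ⟨m, hm, hle⟩ := hcompact.exists_forall_le' hf.continuousOn (a := 0) fun x hx =>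
    hpos x hx.2 (Metric.ne_of_mem_sphere hx.1 one_ne_zero)
  refine ⟨m, hm, fun x hx => ?_⟩
  rcases eq_or_ne x 0 with rfl | hx₀
  · simpa using (hsmul 0 0).ge
  · have hunit := hle (‖x‖⁻¹ • x) ⟨by simp [norm_smul, hx₀], W.smul_mem _ hx⟩
    rwa [hsmul, inv_pow, ← div_eq_inv_mul, le_div_iff₀ (by positivity)] at hunit

lemma norm_sub_le_sum {ι : Type*} [Fintype ι] {p r : ι → ℝ} (hp : ∀ i, 0 ≤ p i)
    (hr : ∀ i, 0 ≤ r i) (hsum : ∑ i, p i = ∑ i, r i) : ‖p - r‖ ≤ ∑ i, r i := by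
  refine (pi_norm_le_iff_of_nonneg (Finset.sum_nonneg fun i _ => hr i)).2 fun i => ?_
  rw [Pi.sub_apply, Real.norm_eq_abs]
  refine abs_sub_le_of_nonneg_of_le (hp i) ?_ (hr i) ?_
  · exact hsum ▸ Finset.single_le_sum (f := p) (fun i _ => hp i) (Finset.mem_univ i)
  · exact Finset.single_le_sum (f := r) (fun i _ => hr i) (Finset.mem_univ i)

lemma sum_add_smul_eq {ι : Type*} [Fintype ι] {η : ι → ℝ} (hη : ∑ i, η i = 0) (r : ι → ℝ)
    (t : ℝ) : ∑ i, (r + t • η) i = ∑ i, r i := by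
  simp only [Pi.add_apply, Pi.smul_apply, smul_eq_mul, Finset.sum_add_distrib, ← Finset.mul_sum,
    hη, mul_zero, add_zero]

end Norms

section Comparison

variable {V : Type*} [Fintype V] [DecidableEq V] {T : AbstractSimplicialComplex V}
  {r η p : V → ℝ}

lemma extCurvature_dotProduct_eq_zero (hr : IsConstantCurvaturePacking T r)
    (hη : ∑ i, η i = 0) : extCurvature T r ⬝ᵥ η = 0 := by
  obtain ⟨hr, c, hc⟩ := hr
  simp only [dotProduct, ← curvature_eq_extCurvature hr, hc, ← Finset.mul_sum, hη, mul_zero]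

lemma totalCurvature_add_smul_mono (hr : IsConstantCurvaturePacking T r) (hη : ∑ i, η i = 0)
    {s t : ℝ} (hs : 0 ≤ s) (hst : s ≤ t) (ht : ∀ i, 0 < (r + t • η) i) :
    totalCurvature T (r + s • η) ≤ totalCurvature T (r + t • η) := by
  have hslope : 0 ≤ extCurvature T (r + s • η) ⬝ᵥ η := by
    have hmono := monotoneOn_extCurvature_dotProduct hr.1 ht (left_mem_Icc.2 (hs.trans hst))
      ⟨hs, hst⟩ hs
    simpa only [zero_smul, add_zero, extCurvature_dotProduct_eq_zero hr hη] using hmono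
  exact sub_nonneg.1 ((mul_nonneg (sub_nonneg.2 hst) hslope).trans
    (mul_le_totalCurvature_sub hr.1 ht hs hst le_rfl))

lemma totalCurvature_le (hr : IsConstantCurvaturePacking T r) (hp : ∀ i, 0 < p i)
    (hsum : ∑ i, p i = ∑ i, r i) : totalCurvature T r ≤ totalCurvature T p := by
  have hmono := totalCurvature_add_smul_mono (η := p - r) hr
    (by simp [Finset.sum_sub_distrib, hsum]) le_rfl zero_le_one (by simpa using hp)
  simpa using hmono

lemma totalCurvature_sub_le (hr : r ∈ packings T) (hp : ∀ i, 0 < p i) :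
    totalCurvature T p - totalCurvature T r ≤ extCurvature T p ⬝ᵥ (p - r) := by
  simpa using totalCurvature_sub_le_mul (η := p - r) (τ := 1) (s := 0) (t := 1) hr
    (by simpa using hp) le_rfl zero_le_one le_rfl

lemma isConstantCurvaturePacking_of_totalCurvature_le (hr : IsConstantCurvaturePacking T r)
    (hp : p ∈ packings T) (hsum : ∑ i, p i = ∑ i, r i)
    (hle : totalCurvature T p ≤ totalCurvature T r) : IsConstantCurvaturePacking T p := by
  have hcritical {η : V → ℝ} (hη : ∑ i, η i = 0) : extCurvature T p ⬝ᵥ η = 0 := by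
    have hderiv := hasDerivAt_totalCurvature (T := T) (hasDerivAt_add_smul p η 0)
      (by simpa using hp.1) (by simpa using fun q hq => ((mem_packings_iff.1 hp).2 q hq).ne')
    have hmin : IsLocalMin (fun s : ℝ => totalCurvature T (p + s • η)) 0 := by
      have hpos : ∀ᶠ s : ℝ in nhds 0, ∀ i, 0 < (p + s • η) i :=
        Filter.eventually_all.2 fun i => (continuousAt_pi.1
          (hasDerivAt_add_smul p η 0).continuousAt i).eventually_const_lt (by simpa using hp.1 i)
      filter_upwards [hpos] with s hs
      simpa using hle.trans (totalCurvature_le hr hs ((sum_add_smul_eq hη p s).trans hsum))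
    simpa using hmin.hasDerivAt_eq_zero hderiv
  have hconst (i j : V) : extCurvature T p i = extCurvature T p j := by
    have hdir := hcritical (η := Pi.single i 1 - Pi.single j 1)
      (by simp [Finset.sum_sub_distrib])
    simpa [dotProduct_sub, sub_eq_zero] using hdir
  refine ⟨hp, ?_⟩
  rw [curvature_eq_extCurvature hp]
  rcases isEmpty_or_nonempty V with hV | ⟨⟨j⟩⟩
  · exact ⟨0, hV.elim⟩
  · exact ⟨extCurvature T p j, fun i => hconst i j⟩

/-- Nondegeneracy of the second variation of the total curvature at `r`, restricted to
variations that keep the sum of the radii. -/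
def IsRigid (T : AbstractSimplicialComplex V) (r : V → ℝ) : Prop :=
  ∀ η : V → ℝ, ∑ i, η i = 0 → η ⬝ᵥ curvatureDeriv T r η = 0 → η = 0

lemma IsRigid.exists_mul_norm_sq_le (hrigid : IsRigid T r) (hr : r ∈ packings T) :
    ∃ m > 0, ∀ η : V → ℝ, ∑ i, η i = 0 → m * ‖η‖ ^ 2 ≤ η ⬝ᵥ curvatureDeriv T r η := by
  simp only [← fderiv_extCurvature hr]
  let W : Submodule ℝ (V → ℝ) := LinearMap.ker (∑ i, LinearMap.proj i)
  have hW (η : V → ℝ) : η ∈ W ↔ ∑ i, η i = 0 := by simp [W]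
  simp only [← hW]
  refine BallPacking.exists_mul_norm_sq_le (by fun_prop) (fun c η => ?_) fun η hη hη₀ => ?_
  · rw [map_smul, smul_dotProduct, dotProduct_smul]
    simp only [smul_eq_mul]
    ring
  · rw [fderiv_extCurvature hr]
    exact (dotProduct_curvatureDeriv_nonneg hr.1 η).lt_of_ne
      fun h => hη₀ (hrigid η ((hW η).1 hη) h.symm)

lemma IsRigid.exists_mul_norm_sq_le_extCurvature_dotProduct (hrigid : IsRigid T r)
    (hr : IsConstantCurvaturePacking T r) :
    ∃ m > 0, ∃ δ > 0, ∀ η : V → ℝ, ‖η‖ < δ → ∑ i, η i = 0 →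
      m * ‖η‖ ^ 2 ≤ extCurvature T (r + η) ⬝ᵥ η := by
  obtain ⟨m, hm, hform⟩ := hrigid.exists_mul_norm_sq_le hr.1
  let ε := m / (2 * (Fintype.card V + 1))
  have hε : 0 < ε := by positivity
  have hderiv := ((contDiffAt_extCurvature hr.1).differentiableAt one_ne_zero).hasFDerivAt
  have hremainder := (hasFDerivAt_iff_isLittleO_nhds_zero.1 hderiv).bound hε
  obtain ⟨δ, hδ, hball⟩ := Metric.eventually_nhds_iff.1 hremainder
  refine ⟨m / 2, by positivity, δ, hδ, fun η hη hsum => ?_⟩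
  have herror := hball (y := η) (by simpa using hη)
  rw [fderiv_extCurvature hr.1] at herror
  set E := extCurvature T (r + η) - extCurvature T r - curvatureDeriv T r η with hE
  have hsplit : extCurvature T (r + η) ⬝ᵥ η = η ⬝ᵥ curvatureDeriv T r η + E ⬝ᵥ η := by
    rw [hE, sub_dotProduct, sub_dotProduct, extCurvature_dotProduct_eq_zero hr hsum,
      dotProduct_comm η]
    ring
  have hE_le : |E ⬝ᵥ η| ≤ m / 2 * ‖η‖ ^ 2 := by
    calc |E ⬝ᵥ η| ≤ Fintype.card V * (‖E‖ * ‖η‖) := abs_dotProduct_le E η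
      _ ≤ (Fintype.card V + 1) * (ε * ‖η‖ * ‖η‖) := by gcongr; linarith
      _ = m / 2 * ‖η‖ ^ 2 := by simp only [ε]; field_simp
  rw [hsplit]
  linarith [hform η hsum, neg_abs_le (E ⬝ᵥ η)]

lemma IsRigid.exists_mul_norm_sq_le_totalCurvature_sub (hrigid : IsRigid T r)
    (hr : IsConstantCurvaturePacking T r) :
    ∃ m > 0, ∀ p : V → ℝ, (∀ i, 0 < p i) → ∑ i, p i = ∑ i, r i →
      m * ‖p - r‖ ^ 2 ≤ totalCurvature T p - totalCurvature T r := by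
  obtain ⟨m, hm, δ, hδ, hlocal⟩ := hrigid.exists_mul_norm_sq_le_extCurvature_dotProduct hr
  let S := ∑ i, r i
  have hS : 0 ≤ S := Finset.sum_nonneg fun i _ => (hr.1.1 i).le
  let s := min (1 / 2) (δ / (S + 1))
  have hs : 0 < s := lt_min (by norm_num) (by positivity)
  have hs_half : s ≤ 1 / 2 := min_le_left _ _
  refine ⟨m * s / 2, by positivity, fun p hp hsum => ?_⟩
  have hη : ∑ i, (p - r) i = 0 := by simp [Finset.sum_sub_distrib, hsum]
  have hend : ∀ i, 0 < (r + (1 : ℝ) • (p - r)) i := by simpa using hp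
  have hsmall : ‖s • (p - r)‖ < δ := by
    rw [norm_smul, Real.norm_of_nonneg hs.le]
    calc s * ‖p - r‖ ≤ δ / (S + 1) * S := mul_le_mul (min_le_right _ _)
          (norm_sub_le_sum (fun i => (hp i).le) (fun i => (hr.1.1 i).le) hsum) (norm_nonneg _)
          (by positivity)
      _ < δ := by
          rw [div_mul_eq_mul_div, div_lt_iff₀ (by positivity)]
          linarith [mul_add δ S 1]
  have hslope : m * s * ‖p - r‖ ^ 2 ≤ extCurvature T (r + s • (p - r)) ⬝ᵥ (p - r) := by
    have hlocal_s := hlocal (s • (p - r)) hsmall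
      (by simpa using sum_add_smul_eq hη 0 s)
    rw [norm_smul, Real.norm_of_nonneg hs.le, dotProduct_smul, smul_eq_mul] at hlocal_s
    refine le_of_mul_le_mul_left ?_ hs
    linarith [mul_pow s ‖p - r‖ 2]
  have hstart := totalCurvature_le hr (add_smul_pos hr.1.1 hend ⟨hs.le, by linarith⟩)
    (sum_add_smul_eq hη r s)
  have hrest := mul_le_totalCurvature_sub hr.1 hend hs.le (by linarith) le_rfl
  rw [one_smul, add_sub_cancel] at hrest
  have hhalf : m * s * ‖p - r‖ ^ 2 * (1 / 2) ≤
      (1 - s) * (extCurvature T (r + s • (p - r)) ⬝ᵥ (p - r)) := by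
    rw [mul_comm]
    exact mul_le_mul (by linarith) hslope (by positivity) (by linarith)
  linarith

end Comparison

/-! ### Sublevel sets of the average curvature below `chi` -/

section Sublevel

lemma mem_packings_of_lt_exitTime {V : Type*} [DecidableEq V] {T : AbstractSimplicialComplex V}
    {r η : V → ℝ} {t : ℝ} (ht : t ∈ Ico 0 (exitTime T r η)) : r + t • η ∈ packings T := by
  obtain ⟨a, ha, hta⟩ := exists_lt_of_lt_csSup
    (s := {a : ℝ | ∀ t ∈ Ico 0 a, r + t • η ∈ packings T})
    ⟨0, fun s hs => absurd hs.2 hs.1.not_gt⟩ ht.2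
  exact ha t ⟨ht.1, hta⟩

variable {V : Type*} [Fintype V] [DecidableEq V] {T : AbstractSimplicialComplex V}
  {r η p : V → ℝ} {μ : ℝ}

lemma totalCurvature_eq_avgCurvature_mul (hr : r ∈ packings T) :
    totalCurvature T r = avgCurvature T r * ∑ i, r i := by
  rcases isEmpty_or_nonempty V with hV | hV
  · simp [totalCurvature, dotProduct]
  · rw [avgCurvature_eq hr,
      div_mul_cancel₀ _ (Finset.sum_pos (fun i _ => hr.1 i) Finset.univ_nonempty).ne']

lemma exists_lt_totalCurvature_of_lt_chi (hμ : (μ : EReal) < chi T r) (hη : ∑ i, η i = 0)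
    (hη₀ : η ≠ 0) : ∃ t : ℝ, 0 ≤ t ∧ (∀ s ∈ Icc 0 t, r + s • η ∈ packings T) ∧
      μ * ∑ i, r i < totalCurvature T (r + t • η) := by
  have hsq : 0 < ∑ i, η i ^ 2 := by
    obtain ⟨i, hi⟩ := Function.ne_iff.1 hη₀
    exact Finset.sum_pos' (fun i _ => sq_nonneg _) ⟨i, Finset.mem_univ i, pow_two_pos_of_ne_zero hi⟩
  set ℓ := √(∑ i, η i ^ 2)
  have hℓ : 0 < ℓ := Real.sqrt_pos.2 hsq
  have hdirection : ℓ⁻¹ • η ∈ directions V := by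
    constructor
    · simp only [Pi.smul_apply, smul_eq_mul, mul_pow, ← Finset.mul_sum]
      rw [inv_pow, Real.sq_sqrt hsq.le, inv_mul_cancel₀ hsq.ne']
    · simp only [Pi.smul_apply, smul_eq_mul, ← Finset.mul_sum, hη, mul_zero]
  obtain ⟨t, ht, hlt⟩ := by
    simpa only [lt_iSup_iff] using hμ.trans_le (iInf₂_le (ℓ⁻¹ • η) hdirection)
  have hmem {s : ℝ} (hs : s ∈ Icc 0 (t * ℓ⁻¹)) : r + s • η ∈ packings T := by
    have hexit : s * ℓ ∈ Ico 0 (exitTime T r (ℓ⁻¹ • η)) :=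
      ⟨mul_nonneg hs.1 hℓ.le, ((le_mul_inv_iff₀ hℓ).1 hs.2).trans_lt ht.2⟩
    simpa [smul_smul, hℓ.ne'] using mem_packings_of_lt_exitTime hexit
  have hend : 0 ≤ t * ℓ⁻¹ := mul_nonneg ht.1 (inv_pos.2 hℓ).le
  have hq := hmem (right_mem_Icc.2 hend)
  refine ⟨t * ℓ⁻¹, hend, fun s => hmem, ?_⟩
  have : Nonempty V := (Function.ne_iff.1 hη₀).nonempty
  have hsum := sum_add_smul_eq hη r (t * ℓ⁻¹)
  rw [totalCurvature_eq_avgCurvature_mul hq, hsum]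
  rw [smul_smul, EReal.coe_lt_coe_iff] at hlt
  exact mul_lt_mul_of_pos_right hlt
    (hsum ▸ Finset.sum_pos (fun i _ => hq.1 i) Finset.univ_nonempty)

/-- The weights with the same total radius as `r` whose average curvature, extended to degenerate
weights, is at most `μ`. -/
def curvatureSublevel (T : AbstractSimplicialComplex V) (r : V → ℝ) (μ : ℝ) : Set (V → ℝ) :=
  {p | (∀ i, 0 < p i) ∧ ∑ i, p i = ∑ i, r i ∧ totalCurvature T p ≤ μ * ∑ i, r i}

lemma exists_one_lt_of_mem_curvatureSublevel (hr : IsConstantCurvaturePacking T r)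
    (hμ : (μ : EReal) < chi T r) (hp : p ∈ curvatureSublevel T r μ) (hpr : p ≠ r) :
    ∃ t : ℝ, 1 < t ∧ (∀ s ∈ Icc 0 t, r + s • (p - r) ∈ packings T) ∧
      μ * ∑ i, r i < totalCurvature T (r + t • (p - r)) := by
  have hη : ∑ i, (p - r) i = 0 := by simp [Finset.sum_sub_distrib, hp.2.1]
  obtain ⟨t, ht, hmem, hlt⟩ := exists_lt_totalCurvature_of_lt_chi hμ hη (sub_ne_zero.2 hpr)
  refine ⟨t, lt_of_not_ge fun ht_one => ?_, hmem, hlt⟩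
  have hmono := totalCurvature_add_smul_mono (t := 1) hr hη ht ht_one (by simpa using hp.1)
  rw [one_smul, add_sub_cancel] at hmono
  exact absurd hlt (hmono.trans hp.2.2).not_gt

lemma curvatureSublevel_subset_packings (hr : IsConstantCurvaturePacking T r)
    (hμ : (μ : EReal) < chi T r) : curvatureSublevel T r μ ⊆ packings T := by
  intro p hp
  rcases eq_or_ne p r with rfl | hpr
  · exact hr.1
  · obtain ⟨t, ht, hmem, -⟩ := exists_one_lt_of_mem_curvatureSublevel hr hμ hp hpr
    simpa using hmem 1 ⟨zero_le_one, ht.le⟩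

lemma exists_totalCurvature_add_smul_sub_le (hr : r ∈ packings T) :
    ∃ C > 0, ∀ p : V → ℝ, (∀ i, 0 < p i) → ∑ i, p i = ∑ i, r i →
      ∀ t ≥ 1, (∀ i, 0 < (r + t • (p - r)) i) →
        totalCurvature T (r + t • (p - r)) - totalCurvature T p ≤
          (t - 1) * (C * ∑ i, r i) := by
  obtain ⟨B, hB⟩ := exists_norm_extCurvature_le T
  have hB₀ : 0 ≤ B := (norm_nonneg _).trans (hB r)
  refine ⟨Fintype.card V * B + 1, by positivity, fun p hp hsum t ht hend => ?_⟩
  have hS : 0 ≤ ∑ i, r i := Finset.sum_nonneg fun i _ => (hr.1 i).le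
  have hchord := totalCurvature_sub_le_mul hr hend zero_le_one ht le_rfl
  rw [one_smul, add_sub_cancel] at hchord
  refine hchord.trans (mul_le_mul_of_nonneg_left ?_ (sub_nonneg.2 ht))
  calc extCurvature T (r + t • (p - r)) ⬝ᵥ (p - r)
      ≤ Fintype.card V * (‖extCurvature T (r + t • (p - r))‖ * ‖p - r‖) :=
        (le_abs_self _).trans (abs_dotProduct_le _ _)
    _ ≤ Fintype.card V * (B * ∑ i, r i) := by
        gcongr
        · exact hB _
        · exact norm_sub_le_sum (fun i => (hp i).le) (fun i => (hr.1 i).le) hsum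
    _ ≤ (Fintype.card V * B + 1) * ∑ i, r i := by linarith

/-- The ray from `r` through `p` stays in the packings until its total curvature exceeds a level
`μ' > μ`. Since the curvature is bounded, this happens at a definite distance beyond `p`. -/
lemma exists_mul_le_of_mem_curvatureSublevel (hr : IsConstantCurvaturePacking T r)
    (hμ : (μ : EReal) < chi T r) :
    ∃ θ > 0, ∀ p ∈ curvatureSublevel T r μ, ∀ i, θ * r i ≤ p i := by
  obtain ⟨μ', hμ₁, hμ'⟩ := EReal.lt_iff_exists_real_btwn.1 hμ
  have hμμ' : 0 < μ' - μ := sub_pos.2 (EReal.coe_lt_coe_iff.1 hμ₁)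
  obtain ⟨C, hC, hbound⟩ := exists_totalCurvature_add_smul_sub_le hr.1
  let κ := (μ' - μ) / C
  have hκ : 0 < κ := div_pos hμμ' hC
  refine ⟨κ / (1 + κ), by positivity, fun p hp i => ?_⟩
  have : Nonempty V := ⟨i⟩
  have hR : 0 < ∑ i, r i := Finset.sum_pos (fun i _ => hr.1.1 i) Finset.univ_nonempty
  have hri := hr.1.1 i
  rw [div_mul_eq_mul_div, div_le_iff₀ (by positivity)]
  rcases eq_or_ne p r with rfl | hpr
  · nlinarith
  have hp' : p ∈ curvatureSublevel T r μ' :=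
    ⟨hp.1, hp.2.1, hp.2.2.trans (mul_le_mul_of_nonneg_right (sub_pos.1 hμμ').le hR.le)⟩
  obtain ⟨t, ht, hmem, hlt⟩ := exists_one_lt_of_mem_curvatureSublevel hr hμ' hp' hpr
  have hq := hmem t ⟨by linarith, le_rfl⟩
  have hκt : κ ≤ t - 1 := by
    refine (div_le_iff₀ hC).2 (le_of_mul_le_mul_right ?_ hR)
    linarith [hp.2.2, hbound p hp.1 hp.2.1 t ht.le hq.1]
  have hqi := hq.1 i
  simp only [Pi.add_apply, Pi.smul_apply, Pi.sub_apply, smul_eq_mul] at hqi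
  have hpi := hp.1 i
  rcases le_or_gt (r i) (p i) with hle | hgt
  · nlinarith
  · nlinarith [mul_le_mul_of_nonneg_right hκt (sub_pos.2 hgt).le]

lemma isCompact_curvatureSublevel (hr : IsConstantCurvaturePacking T r)
    (hμ : (μ : EReal) < chi T r) : IsCompact (curvatureSublevel T r μ) := by
  obtain ⟨θ, hθ, hlower⟩ := exists_mul_le_of_mem_curvatureSublevel hr hμ
  let C : Set (V → ℝ) := Icc (θ • r) (fun _ => ∑ i, r i) ∩ {p | ∑ i, p i = ∑ i, r i}
  have hC : IsCompact C := isCompact_Icc.inter_right (isClosed_eq (by fun_prop) continuous_const)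
  have hpos {p : V → ℝ} (hp : p ∈ C) (i : V) : 0 < p i :=
    (mul_pos hθ (hr.1.1 i)).trans_le (hp.1.1 i)
  have heq : curvatureSublevel T r μ = C ∩ totalCurvature T ⁻¹' Iic (μ * ∑ i, r i) := by
    refine Subset.antisymm (fun p hp => ⟨⟨⟨hlower p hp, fun i => ?_⟩, hp.2.1⟩, hp.2.2⟩)
      fun p hp => ⟨hpos hp.1, hp.1.2, hp.2⟩
    exact hp.2.1 ▸ Finset.single_le_sum (f := p) (fun i _ => (hp.1 i).le) (Finset.mem_univ i)
  rw [heq]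
  exact hC.of_isClosed_subset (ContinuousOn.preimage_isClosed_of_isClosed
    (fun p hp => (continuousAt_totalCurvature (hpos hp)).continuousWithinAt) hC.isClosed
    isClosed_Iic) inter_subset_left

/-- A null variation scales each tetrahedron, so the ray in its direction keeps the curvature and
cannot reach a total curvature above that of `r`. -/
lemma isRigid_of_avgCurvature_lt_chi (hr : IsConstantCurvaturePacking T r)
    (hlt : (avgCurvature T r : EReal) < chi T r) : IsRigid T r := by
  intro η hη hform
  by_contra hη₀
  obtain ⟨t, ht, hmem, hlt⟩ := exists_lt_totalCurvature_of_lt_chi hlt hη hη₀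
  have hq := hmem t ⟨ht, le_rfl⟩
  have hcurvature : extCurvature T (r + t • η) = extCurvature T r := by
    funext i
    refine extCurvature_congr fun q hqT _ => ?_
    have hscale (m : Fin 4) :
        (r + t • η) (q m) = (1 + t * ((r (q 3))⁻¹ * η (q 3))) * r (q m) := by
      rw [← div_eq_div_of_dotProduct_curvatureDeriv_eq_zero hr.1 hform hqT m]
      have := (hr.1.1 (q m)).ne'
      simp only [Pi.add_apply, Pi.smul_apply, smul_eq_mul]
      field_simp
    have hpos := hq.1 (q 3)
    rw [hscale 3] at hpos
    exact ⟨_, pos_of_mul_pos_left hpos (hr.1.1 _).le, hscale⟩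
  rw [← totalCurvature_eq_avgCurvature_mul hr.1, totalCurvature, totalCurvature, hcurvature,
    dotProduct_add, dotProduct_smul, extCurvature_dotProduct_eq_zero hr hη, smul_zero,
    add_zero] at hlt
  exact lt_irrefl _ hlt

end Sublevel

/-! ### Autonomous differential equations on an open set -/

section ODE

open Topology Filter
open scoped Manifold

variable {E : Type*} [NormedAddCommGroup E] [NormedSpace ℝ E]

lemma exists_isIntegralCurve_of_hasCompactSupport [CompleteSpace E] {w : E → E}
    (hw : ContDiff ℝ 1 w) (hsupp : HasCompactSupport w) (x₀ : E) :
    ∃ α : ℝ → E, α 0 = x₀ ∧ IsIntegralCurve α fun _ => w := by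
  obtain ⟨C, hC⟩ := hw.lipschitzWith_of_hasCompactSupport hsupp one_ne_zero
  obtain ⟨L, hL⟩ := hsupp.exists_bound_of_continuous hw.continuous
  have hlocal (a : ℝ) : ∃ α : ℝ → E, α 0 = x₀ ∧
      IsMIntegralCurveOn (I := 𝓘(ℝ, E)) α w (Ioo (-a) a) := by
    have h₀ : (0 : ℝ) ∈ Icc (-|a|) |a| := ⟨neg_nonpos.2 (abs_nonneg a), abs_nonneg a⟩
    have hpl : IsPicardLindelof (fun _ => w) ⟨0, h₀⟩ x₀ (L.toNNReal * ‖a‖₊) 0 L.toNNReal C :=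
      .of_time_independent (fun x _ => (hL x).trans (Real.le_coe_toNNReal L))
        hC.lipschitzOnWith (by simp)
    obtain ⟨α, hα₀, hα⟩ := hpl.exists_eq_forall_mem_Icc_hasDerivWithinAt₀
    have hsub : Ioo (-a) a ⊆ Icc (-|a|) |a| :=
      Ioo_subset_Icc_self.trans (Icc_subset_Icc (neg_le_neg (le_abs_self a)) (le_abs_self a))
    exact ⟨α, hα₀, fun t ht => hasMFDerivWithinAt_iff_hasFDerivWithinAt.2
      ((hα t (hsub ht)).mono hsub).hasFDerivWithinAt⟩
  obtain ⟨α, h₀, hα⟩ :=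
    (exists_isMIntegralCurve_iff_exists_isMIntegralCurveOn_Ioo (I := 𝓘(ℝ, E))
      (contMDiff_vectorSpace_iff_contDiff.2 hw) x₀).2 hlocal
  exact ⟨α, h₀, fun t => hasMFDerivAt_iff_hasFDerivAt.1 (hα t)⟩

variable [FiniteDimensional ℝ E] {U K : Set E} {v : E → E}

lemma exists_hasCompactSupport_eventuallyEq (hU : IsOpen U) (hv : ∀ x ∈ U, ContDiffAt ℝ 1 v x)
    (hK : IsCompact K) (hKU : K ⊆ U) :
    ∃ w : E → E, ContDiff ℝ 1 w ∧ HasCompactSupport w ∧ w =ᶠ[𝓝ˢ K] v := by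
  obtain ⟨K', hK', hKK', hK'U⟩ := exists_compact_between hK hU hKU
  obtain ⟨ρ, hρ_one, hρ_zero, -⟩ := exists_contMDiffMap_one_nhds_of_subset_interior
    (n := 1) 𝓘(ℝ, E) hK.isClosed hKK'
  refine ⟨fun x => ρ x • v x, contDiff_iff_contDiffAt.2 fun x => ?_,
    .intro hK' fun x hx => by rw [hρ_zero x hx, zero_smul], hρ_one.mono fun x hx => by simp [hx]⟩
  by_cases hx : x ∈ U
  · exact ρ.contMDiff.contDiff.contDiffAt.smul (hv x hx)
  · have hzero : (fun x => ρ x • v x) =ᶠ[𝓝 x] fun _ => 0 := by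
      filter_upwards [hK'.isClosed.isOpen_compl.mem_nhds fun h => hx (hK'U h)] with y hy
      rw [hρ_zero y hy, zero_smul]
    exact contDiffAt_const.congr_of_eventuallyEq hzero

lemma eqOn_of_isIntegralCurveOn (hU : IsOpen U) (hv : ∀ x ∈ U, ContDiffAt ℝ 1 v x)
    {α β : ℝ → E} {τ : ℝ} (hα : IsIntegralCurveOn α (fun _ => v) (Icc 0 τ))
    (hαU : MapsTo α (Icc 0 τ) U) (hβ : IsIntegralCurveOn β (fun _ => v) (Icc 0 τ))
    (hβU : MapsTo β (Icc 0 τ) U) (h₀ : α 0 = β 0) : EqOn α β (Icc 0 τ) := by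
  obtain ⟨w, hw, hsupp, hwv⟩ := exists_hasCompactSupport_eventuallyEq hU hv
    ((isCompact_Icc.image_of_continuousOn hα.continuousOn).union
      (isCompact_Icc.image_of_continuousOn hβ.continuousOn))
    (union_subset hαU.image_subset hβU.image_subset)
  obtain ⟨C, hC⟩ := hw.lipschitzWith_of_hasCompactSupport hsupp one_ne_zero
  have hderiv {γ : ℝ → E} (hγ : IsIntegralCurveOn γ (fun _ => v) (Icc 0 τ))
      (hγK : γ '' Icc 0 τ ⊆ α '' Icc 0 τ ∪ β '' Icc 0 τ) (t : ℝ) (ht : t ∈ Ico 0 τ) :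
      HasDerivWithinAt γ (w (γ t)) (Ici t) t := by
    have ht' := Ico_subset_Icc_self ht
    rw [hwv.self_of_nhdsSet (hγK (mem_image_of_mem γ ht'))]
    exact (hγ t ht').mono_of_mem_nhdsWithin
      (mem_of_superset (Icc_mem_nhdsGE ht.2) (Icc_subset_Icc_left ht.1))
  exact ODE_solution_unique (fun _ => hC) hα.continuousOn (hderiv hα subset_union_left)
    hβ.continuousOn (hderiv hβ subset_union_right) h₀

/-- If solutions starting at `x₀` cannot leave the compact set `K` before leaving the domain `U` of
the equation, they exist forever and stay in `K`. -/
lemma exists_forall_mem_and_hasDerivAt (hU : IsOpen U) (hv : ∀ x ∈ U, ContDiffAt ℝ 1 v x)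
    (hK : IsCompact K) (hKU : K ⊆ U) {x₀ : E} (hx₀ : x₀ ∈ K)
    (htrap : ∀ α : ℝ → E, ∀ τ : ℝ, 0 ≤ τ → α 0 = x₀ →
      (∀ t ∈ Icc 0 τ, α t ∈ U ∧ HasDerivAt α (v (α t)) t) → α τ ∈ K) :
    ∃ α : ℝ → E, α 0 = x₀ ∧ ∀ t ≥ 0, α t ∈ K ∧ HasDerivAt α (v (α t)) t := by
  obtain ⟨w, hw, hsupp, hwv⟩ := exists_hasCompactSupport_eventuallyEq hU hv hK hKU
  obtain ⟨W, hW, hKW, hWv⟩ := eventually_nhdsSet_iff_exists.1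
    (hwv.and (hU.mem_nhdsSet.2 hKU))
  obtain ⟨α, h₀, hα⟩ := exists_isIntegralCurve_of_hasCompactSupport hw hsupp x₀
  have hflow {t : ℝ} (ht : α t ∈ W) : α t ∈ U ∧ HasDerivAt α (v (α t)) t :=
    ⟨(hWv _ ht).2, (hWv _ ht).1 ▸ hα t⟩
  suffices hstay : ∀ t ≥ 0, α t ∈ W from ⟨α, h₀, fun t ht =>
    ⟨htrap α t ht h₀ fun s hs => hflow (hstay s hs.1), (hflow (hstay t ht)).2⟩⟩
  by_contra! hleave
  let exits := Ici 0 ∩ α ⁻¹' Wᶜ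
  have hexits : IsClosed exits := isClosed_Ici.inter (hW.isClosed_compl.preimage hα.continuous)
  have hbdd : BddBelow exits := ⟨0, fun t ht => ht.1⟩
  have hfirst : sInf exits ∈ exits := hexits.csInf_mem hleave hbdd
  have hbefore : ∀ t ∈ Ico 0 (sInf exits), α t ∈ K := fun t ht =>
    htrap α t ht.1 h₀ fun s hs => hflow (not_not.1 fun hs' =>
      (hs.2.trans_lt ht.2).not_ge (csInf_le hbdd ⟨hs.1, hs'⟩))
  rcases (mem_Ici.1 hfirst.1).eq_or_lt with hzero | hpos
  · exact hfirst.2 (hKW (hzero ▸ h₀.symm ▸ hx₀))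
  · refine hfirst.2 (hKW (hK.isClosed.closure_subset_iff.2 (image_subset_iff.2 hbefore) ?_))
    exact image_closure_subset_closure_image hα.continuous
      (mem_image_of_mem α (closure_Ico hpos.ne ▸ right_mem_Icc.2 hpos.le))

end ODE

/-! ### The flow -/

section Flow

open Topology Filter

variable {V : Type*} [Fintype V] [DecidableEq V] {T : AbstractSimplicialComplex V}
  {r r₀ : V → ℝ}

/-- The vector field of the normalized combinatorial Yamabe flow. -/
def flowField (T : AbstractSimplicialComplex V) (r : V → ℝ) (i : V) : ℝ :=
  (avgCurvature T r - curvature T r i) * r i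

/-- The rate at which the normalized combinatorial Yamabe flow decreases the total curvature. -/
def dissipation (T : AbstractSimplicialComplex V) (r : V → ℝ) : ℝ :=
  ∑ i, (curvature T r i - avgCurvature T r) ^ 2 * r i

lemma isNormalizedYamabeFlowOn_iff {α : ℝ → V → ℝ} {I : Set ℝ} :
    IsNormalizedYamabeFlowOn T α I ↔
      IsIntegralCurveOn α (fun _ => flowField T) I ∧ MapsTo α I (packings T) := by
  simp only [IsNormalizedYamabeFlowOn, IsIntegralCurveOn, hasDerivWithinAt_pi, flowField]
  exact ⟨fun h => ⟨fun t ht => (h t ht).2, fun t ht => (h t ht).1⟩,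
    fun h t ht => ⟨h.2 ht, h.1 t ht⟩⟩

lemma IsNormalizedYamabeFlowOn.mono {α : ℝ → V → ℝ} {I J : Set ℝ}
    (hα : IsNormalizedYamabeFlowOn T α I) (hJ : J ⊆ I) : IsNormalizedYamabeFlowOn T α J :=
  fun t ht => ⟨(hα t (hJ ht)).1, fun i => ((hα t (hJ ht)).2 i).mono hJ⟩

lemma contDiffAt_flowField (hr : r ∈ packings T) : ContDiffAt ℝ 1 (flowField T) r := by
  have hcoord (i : V) : ContDiffAt ℝ 1 (fun p : V → ℝ => p i) r := contDiffAt_apply ℝ ℝ i r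
  have hcurv (i : V) : ContDiffAt ℝ 1 (fun p => extCurvature T p i) r :=
    contDiffAt_pi.1 (contDiffAt_extCurvature hr) i
  have hext : ContDiffAt ℝ 1
      (fun p i => (totalCurvature T p / ∑ j, p j - extCurvature T p i) * p i) r := by
    refine contDiffAt_pi.2 fun i => .mul (.sub (.div ?_ ?_ ?_) (hcurv i)) (hcoord i)
    · exact .sum fun j _ => (hcurv j).mul (hcoord j)
    · exact .sum fun j _ => hcoord j
    · exact (Finset.sum_pos (fun j _ => hr.1 j) ⟨i, Finset.mem_univ i⟩).ne'
  refine hext.congr_of_eventuallyEq ?_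
  filter_upwards [(isOpen_packings T).mem_nhds hr] with p hp
  funext i
  rw [flowField, avgCurvature_eq hp, curvature_eq_extCurvature hp]

lemma flowField_eq_zero (hr : IsConstantCurvaturePacking T r) : flowField T r = 0 := by
  obtain ⟨hr, c, hc⟩ := hr
  funext i
  have hsum : ∑ j, r j ≠ 0 := (Finset.sum_pos (fun j _ => hr.1 j) ⟨i, Finset.mem_univ i⟩).ne'
  simp only [flowField, avgCurvature, hc, ← Finset.mul_sum, mul_div_cancel_right₀ _ hsum, sub_self,
    zero_mul, Pi.zero_apply]

lemma sum_flowField (hr : r ∈ packings T) : ∑ i, flowField T r i = 0 := by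
  simp only [flowField, sub_mul, Finset.sum_sub_distrib, ← Finset.mul_sum]
  rw [← totalCurvature_eq_avgCurvature_mul hr, totalCurvature, ← curvature_eq_extCurvature hr,
    dotProduct, sub_self]

lemma extCurvature_dotProduct_flowField (hr : r ∈ packings T) :
    extCurvature T r ⬝ᵥ flowField T r = -dissipation T r := by
  calc extCurvature T r ⬝ᵥ flowField T r
      = ∑ i, (curvature T r i - avgCurvature T r) * flowField T r i := by
        rw [← curvature_eq_extCurvature hr, dotProduct]
        simp only [sub_mul, Finset.sum_sub_distrib, ← Finset.mul_sum, sum_flowField hr, mul_zero,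
          sub_zero]
    _ = -dissipation T r := by
        rw [dissipation, ← Finset.sum_neg_distrib]
        exact Finset.sum_congr rfl fun i _ => by rw [flowField]; ring

lemma dissipation_nonneg (hr : r ∈ packings T) : 0 ≤ dissipation T r :=
  Finset.sum_nonneg fun i _ => mul_nonneg (sq_nonneg _) (hr.1 i).le

section Along

variable {α : ℝ → V → ℝ}

lemma hasDerivAt_totalCurvature_flow {t : ℝ} (hα : α t ∈ packings T)
    (hderiv : HasDerivAt α (flowField T (α t)) t) :
    HasDerivAt (fun s => totalCurvature T (α s)) (-dissipation T (α t)) t :=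
  (hasDerivAt_totalCurvature hderiv hα.1
    fun q hq => ((mem_packings_iff.1 hα).2 q hq).ne').congr_deriv
    (extCurvature_dotProduct_flowField hα)

variable {τ : ℝ}
  (hα : ∀ t ∈ Icc 0 τ, α t ∈ packings T ∧ HasDerivAt α (flowField T (α t)) t)
include hα

lemma sum_flow_eq {t : ℝ} (ht : t ∈ Icc 0 τ) : ∑ i, α t i = ∑ i, α 0 i := by
  have hderiv : ∀ s ∈ Icc 0 τ, HasDerivAt (fun s => ∑ i, α s i) 0 s := fun s hs =>
    (HasDerivAt.fun_sum fun i _ => hasDerivAt_pi.1 (hα s hs).2 i).congr_deriv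
      (sum_flowField (hα s hs).1)
  exact constant_of_has_deriv_right_zero (f := fun s => ∑ i, α s i)
    (fun s hs => (hderiv s hs).continuousAt.continuousWithinAt)
    (fun s hs => (hderiv s (Ico_subset_Icc_self hs)).hasDerivWithinAt) t ht

lemma antitoneOn_totalCurvature_flow : AntitoneOn (fun t => totalCurvature T (α t)) (Icc 0 τ) := by
  have hderiv : ∀ t ∈ Icc 0 τ,
      HasDerivAt (fun t => totalCurvature T (α t)) (-dissipation T (α t)) t := fun t ht =>
    hasDerivAt_totalCurvature_flow (hα t ht).1 (hα t ht).2
  refine antitoneOn_of_deriv_nonpos (convex_Icc 0 τ)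
    (fun t ht => (hderiv t ht).continuousAt.continuousWithinAt)
    (fun t ht => (hderiv t (interior_subset ht)).differentiableAt.differentiableWithinAt)
    fun t ht => ?_
  rw [(hderiv t (interior_subset ht)).deriv, neg_nonpos]
  exact dissipation_nonneg (hα t (interior_subset ht)).1

lemma flow_eqOn {β : ℝ → V → ℝ}
    (hβ : ∀ t ∈ Icc 0 τ, β t ∈ packings T ∧ HasDerivAt β (flowField T (β t)) t)
    (h₀ : α 0 = β 0) : EqOn α β (Icc 0 τ) :=
  eqOn_of_isIntegralCurveOn (isOpen_packings T) (fun _ => contDiffAt_flowField)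
    (fun t ht => (hα t ht).2.hasDerivWithinAt) (fun t ht => (hα t ht).1)
    (fun t ht => (hβ t ht).2.hasDerivWithinAt) (fun t ht => (hβ t ht).1) h₀

lemma mem_curvatureSublevel_flow (hsum : ∑ i, α 0 i = ∑ i, r i) {s t : ℝ} (hs : 0 ≤ s)
    (hst : s ≤ t) (ht : t ≤ τ) : α t ∈ curvatureSublevel T r (avgCurvature T (α s)) := by
  have hs' : s ∈ Icc 0 τ := ⟨hs, hst.trans ht⟩
  have ht' : t ∈ Icc 0 τ := ⟨hs.trans hst, ht⟩
  refine ⟨(hα t ht').1.1, (sum_flow_eq hα ht').trans hsum, ?_⟩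
  rw [← hsum, ← sum_flow_eq hα hs', ← totalCurvature_eq_avgCurvature_mul (hα s hs').1]
  exact antitoneOn_totalCurvature_flow hα hs' ht' hst

end Along

lemma exists_flow_short_time (hr₀ : r₀ ∈ packings T) (hdiss : 0 < dissipation T r₀) :
    ∃ β : ℝ → V → ℝ, ∃ t₁ > 0, β 0 = r₀ ∧ totalCurvature T (β t₁) < totalCurvature T r₀ ∧
      ∀ t ∈ Icc 0 t₁, β t ∈ packings T ∧ HasDerivAt β (flowField T (β t)) t := by
  obtain ⟨β, rfl, ε, hε, hβ⟩ :=
    (contDiffAt_flowField hr₀).exists_forall_mem_closedBall_exists_eq_forall_mem_Ioo_hasDerivAt₀ 0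
  have hflow : ∀ᶠ t in 𝓝 (0 : ℝ), β t ∈ packings T ∧ HasDerivAt β (flowField T (β t)) t := by
    refine .and ?_ (mem_of_superset (Ioo_mem_nhds (by linarith) (by linarith)) hβ)
    exact (hβ 0 (by simpa using hε)).continuousAt ((isOpen_packings T).mem_nhds hr₀)
  have hstay : ∀ᶠ t in 𝓝 (0 : ℝ), ∀ s ∈ Icc 0 t,
      β s ∈ packings T ∧ HasDerivAt β (flowField T (β s)) s :=
    (tendsto_const_nhds.Icc tendsto_id).eventually (eventually_smallSets_forall.2 hflow)
  have hdecrease : ∀ᶠ t in 𝓝[>] (0 : ℝ), totalCurvature T (β t) < totalCurvature T (β 0) := by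
    have hslope := (hasDerivAt_iff_tendsto_slope.1 (hasDerivAt_totalCurvature_flow hr₀
      hflow.self_of_nhds.2)).mono_left (nhdsGT_le_nhdsNE 0)
    filter_upwards [hslope.eventually_lt_const (neg_lt_zero.2 hdiss), self_mem_nhdsWithin]
      with t ht ht₀
    rw [slope_def_field, sub_zero, div_lt_iff₀ ht₀, zero_mul] at ht
    exact sub_neg.1 ht
  obtain ⟨t₁, ⟨hlt, ht₁⟩, hstay₁⟩ := ((hdecrease.and self_mem_nhdsWithin).and
    (hstay.filter_mono nhdsWithin_le_nhds)).exists
  exact ⟨β, t₁, ht₁, rfl, hlt, hstay₁⟩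

/-- At the borderline `λ = χ` the sublevel set of the initial value need not be compact, so the flow
first runs for a short time. -/
lemma exists_flow_eventually_mem_curvatureSublevel (hr : IsConstantCurvaturePacking T r)
    (hr₀ : r₀ ∈ packings T) (hsum : ∑ i, r₀ i = ∑ i, r i) (hdiss : 0 < dissipation T r₀)
    (hgap : (avgCurvature T r₀ : EReal) ≤ chi T r) :
    ∃ α : ℝ → V → ℝ, α 0 = r₀ ∧
      (∀ t ≥ 0, α t ∈ packings T ∧ HasDerivAt α (flowField T (α t)) t) ∧
      ∃ μ : ℝ, (μ : EReal) < chi T r ∧ ∃ t₁ ≥ 0, ∀ t ≥ t₁, α t ∈ curvatureSublevel T r μ := by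
  obtain ⟨β, t₁, ht₁, rfl, hβlt, hβ⟩ := exists_flow_short_time hr₀ hdiss
  have ht₁' := right_mem_Icc.2 ht₁.le
  have hμ : (avgCurvature T (β t₁) : EReal) < chi T r := by
    refine lt_of_lt_of_le (EReal.coe_lt_coe_iff.2 ?_) hgap
    rw [totalCurvature_eq_avgCurvature_mul (hβ t₁ ht₁').1,
      totalCurvature_eq_avgCurvature_mul hr₀, sum_flow_eq hβ ht₁'] at hβlt
    exact lt_of_mul_lt_mul_right hβlt (Finset.sum_nonneg fun i _ => (hr₀.1 i).le)
  let K := curvatureSublevel T r (avgCurvature T (β t₁))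
  have htrap {α : ℝ → V → ℝ} {τ : ℝ} (hα₀ : α 0 = β 0)
      (hα : ∀ t ∈ Icc 0 τ, α t ∈ packings T ∧ HasDerivAt α (flowField T (α t)) t)
      (hτ : t₁ ≤ τ) : α τ ∈ K := by
    have heq : α t₁ = β t₁ :=
      flow_eqOn (fun t ht => hα t ⟨ht.1, ht.2.trans hτ⟩) hβ hα₀ ht₁'
    simpa only [heq] using mem_curvatureSublevel_flow hα (hα₀ ▸ hsum) ht₁.le hτ le_rfl
  have hcompact : IsCompact (K ∪ β '' Icc 0 t₁) := (isCompact_curvatureSublevel hr hμ).union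
    (isCompact_Icc.image_of_continuousOn fun t ht => (hβ t ht).2.continuousAt.continuousWithinAt)
  have hsub : K ∪ β '' Icc 0 t₁ ⊆ packings T := union_subset
    (curvatureSublevel_subset_packings hr hμ) (image_subset_iff.2 fun t ht => (hβ t ht).1)
  obtain ⟨α, hα₀, hα⟩ : ∃ α : ℝ → V → ℝ, α 0 = β 0 ∧
      ∀ t ≥ 0, α t ∈ K ∪ β '' Icc 0 t₁ ∧ HasDerivAt α (flowField T (α t)) t := by
    refine exists_forall_mem_and_hasDerivAt (isOpen_packings T) (fun _ => contDiffAt_flowField)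
      hcompact hsub (.inr ⟨0, left_mem_Icc.2 ht₁.le, rfl⟩) fun α τ hτ hα₀ hα => ?_
    rcases le_total τ t₁ with h | h
    · exact .inr ⟨τ, ⟨hτ, h⟩, (flow_eqOn hα (fun t ht => hβ t ⟨ht.1, ht.2.trans h⟩) hα₀
        (right_mem_Icc.2 hτ)).symm⟩
    · exact .inl (htrap hα₀ hα h)
  have hflow : ∀ t ≥ 0, α t ∈ packings T ∧ HasDerivAt α (flowField T (α t)) t := fun t ht =>
    ⟨hsub (hα t ht).1, (hα t ht).2⟩
  exact ⟨α, hα₀, hflow, _, hμ, t₁, ht₁.le, fun t => htrap hα₀ fun s hs => hflow s hs.1⟩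

end Flow

/-! ### Convergence -/

section Limit

variable {V : Type*} [Fintype V] [DecidableEq V] {T : AbstractSimplicialComplex V}
  {r r₀ p : V → ℝ} {α : ℝ → V → ℝ}

lemma totalCurvature_sub_le_sum (hr : r ∈ packings T) (hp : p ∈ packings T)
    (hsum : ∑ i, p i = ∑ i, r i) : totalCurvature T p - totalCurvature T r ≤
      ∑ i, (curvature T p i - avgCurvature T p) * (p i - r i) := by
  refine (totalCurvature_sub_le hr hp.1).trans_eq ?_
  simp only [← curvature_eq_extCurvature hp, dotProduct, Pi.sub_apply, sub_mul,
    Finset.sum_sub_distrib, ← Finset.mul_sum, hsum, sub_self, mul_zero, sub_zero]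

lemma totalCurvature_sub_sq_le (hr : r ∈ packings T) (hp : p ∈ packings T)
    (hsum : ∑ i, p i = ∑ i, r i) (hle : totalCurvature T r ≤ totalCurvature T p) :
    (totalCurvature T p - totalCurvature T r) ^ 2 ≤
      dissipation T p * ∑ i, (p i - r i) ^ 2 / p i := by
  calc (totalCurvature T p - totalCurvature T r) ^ 2
      ≤ (∑ i, (curvature T p i - avgCurvature T p) * (p i - r i)) ^ 2 :=
        pow_le_pow_left₀ (sub_nonneg.2 hle) (totalCurvature_sub_le_sum hr hp hsum) 2
    _ ≤ dissipation T p * ∑ i, (p i - r i) ^ 2 / p i :=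
        Finset.sum_sq_le_sum_mul_sum_of_sq_le_mul _
          (fun i _ => mul_nonneg (sq_nonneg _) (hp.1 i).le)
          (fun i _ => div_nonneg (sq_nonneg _) (hp.1 i).le)
          fun i _ => by rw [← mul_div_assoc, le_div_iff₀ (hp.1 i)]; exact le_of_eq (by ring)

lemma dissipation_pos (hr : r ∈ packings T) (hp : p ∈ packings T)
    (hsum : ∑ i, p i = ∑ i, r i) (hlt : totalCurvature T r < totalCurvature T p) :
    0 < dissipation T p := by
  refine (dissipation_nonneg hp).lt_of_ne fun h => ?_
  have hsq := totalCurvature_sub_sq_le hr hp hsum hlt.le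
  rw [← h, zero_mul] at hsq
  exact (pow_pos (sub_pos.2 hlt) 2).not_ge hsq

lemma IsRigid.exists_mul_totalCurvature_sub_le_dissipation (hrigid : IsRigid T r)
    (hr : IsConstantCurvaturePacking T r) {θ : ℝ} (hθ : 0 < θ) :
    ∃ k > 0, ∀ p ∈ packings T, ∑ i, p i = ∑ i, r i → (∀ i, θ * r i ≤ p i) →
      k * (totalCurvature T p - totalCurvature T r) ≤ dissipation T p := by
  obtain ⟨m, hm, hgrowth⟩ := hrigid.exists_mul_norm_sq_le_totalCurvature_sub hr
  let W := ∑ i, (θ * r i)⁻¹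
  have hW : 0 ≤ W := Finset.sum_nonneg fun i _ => (inv_pos.2 (mul_pos hθ (hr.1.1 i))).le
  refine ⟨m / (W + 1), by positivity, fun p hp hsum hlower => ?_⟩
  set φ := totalCurvature T p - totalCurvature T r
  have hD := dissipation_nonneg hp
  have hle := totalCurvature_le hr hp.1 hsum
  have hφ : 0 ≤ φ := sub_nonneg.2 hle
  have hweighted : ∑ i, (p i - r i) ^ 2 / p i ≤ ‖p - r‖ ^ 2 * W := by
    rw [Finset.mul_sum]
    refine Finset.sum_le_sum fun i _ => ?_
    rw [div_eq_mul_inv, ← sq_abs]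
    have hi : |p i - r i| ≤ ‖p - r‖ := norm_le_pi_norm (p - r) i
    have hri := mul_pos hθ (hr.1.1 i)
    have hpi := hp.1 i
    gcongr
    exact hlower i
  have hbound : φ * (m * φ) ≤ φ * (dissipation T p * W) := by
    calc φ * (m * φ) = m * φ ^ 2 := by ring
      _ ≤ m * (dissipation T p * (‖p - r‖ ^ 2 * W)) := by
        gcongr
        exact (totalCurvature_sub_sq_le hr.1 hp hsum hle).trans
          (mul_le_mul_of_nonneg_left hweighted hD)
      _ = m * ‖p - r‖ ^ 2 * (dissipation T p * W) := by ring
      _ ≤ φ * (dissipation T p * W) := by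
        gcongr
        exact hgrowth p hp.1 hsum
  rw [div_mul_eq_mul_div, div_le_iff₀ (by positivity)]
  rcases hφ.eq_or_lt with hφ | hφ
  · rw [← hφ, mul_zero]
    positivity
  · linarith [le_of_mul_le_mul_left hbound hφ, mul_add (dissipation T p) W 1]

lemma isRigid_of_mem_curvatureSublevel {μ : ℝ} (hr : IsConstantCurvaturePacking T r)
    (hμ : (μ : EReal) < chi T r) (hp : p ∈ curvatureSublevel T r μ) : IsRigid T r := by
  rcases isEmpty_or_nonempty V with hV | hV
  · exact fun η _ _ => Subsingleton.elim η 0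
  refine isRigid_of_avgCurvature_lt_chi hr (lt_of_le_of_lt (EReal.coe_le_coe_iff.2 ?_) hμ)
  have hle := (totalCurvature_le hr hp.1 hp.2.1).trans hp.2.2
  rw [totalCurvature_eq_avgCurvature_mul hr.1] at hle
  exact le_of_mul_le_mul_right hle (Finset.sum_pos (fun i _ => hr.1.1 i) Finset.univ_nonempty)

lemma le_mul_exp_of_hasDerivAt_le {f f' : ℝ → ℝ} {k a t : ℝ}
    (hf : ∀ s ∈ Icc a t, HasDerivAt f (f' s) s) (hf' : ∀ s ∈ Icc a t, f' s ≤ k * f s)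
    (ht : a ≤ t) : f t ≤ f a * Real.exp (k * (t - a)) := by
  rw [← gronwallBound_ε0]
  exact le_gronwallBound_of_liminf_deriv_right_le
    (fun s hs => (hf s hs).continuousAt.continuousWithinAt)
    (fun s hs _ => (hf s (Ico_subset_Icc_self hs)).hasDerivWithinAt.liminf_right_slope_le)
    le_rfl (fun s hs => by simpa using hf' s (Ico_subset_Icc_self hs)) t (right_mem_Icc.2 ht)

section Convergence

variable {θ t₁ : ℝ} (hrigid : IsRigid T r) (hr : IsConstantCurvaturePacking T r)
  (hα : ∀ t ≥ 0, α t ∈ packings T ∧ HasDerivAt α (flowField T (α t)) t)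
  (hsum : ∑ i, α 0 i = ∑ i, r i) (hθ : 0 < θ) (ht₁ : 0 ≤ t₁)
  (hlower : ∀ t ≥ t₁, ∀ i, θ * r i ≤ α t i)
include hrigid hr hα hsum hθ ht₁ hlower

lemma exists_totalCurvature_flow_sub_le : ∃ C : ℝ, ∃ k > 0, ∀ t ≥ 0,
    totalCurvature T (α t) - totalCurvature T r ≤ C * Real.exp (-k * t) := by
  obtain ⟨k, hk, hdiss⟩ := hrigid.exists_mul_totalCurvature_sub_le_dissipation hr hθ
  let φ (t : ℝ) := totalCurvature T (α t) - totalCurvature T r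
  have hφ₀ : 0 ≤ φ 0 := sub_nonneg.2 (totalCurvature_le hr (hα 0 le_rfl).1.1 hsum)
  have hanti {t : ℝ} (ht : 0 ≤ t) : φ t ≤ φ 0 :=
    sub_le_sub_right (antitoneOn_totalCurvature_flow (fun s hs => hα s hs.1)
      (left_mem_Icc.2 ht) (right_mem_Icc.2 ht) ht) _
  refine ⟨φ 0 * Real.exp (k * t₁), k, hk, fun t ht => ?_⟩
  rw [mul_assoc, ← Real.exp_add]
  rcases le_total t t₁ with h | h
  · have hexponent : 0 ≤ k * t₁ + -k * t := by
      linarith [mul_le_mul_of_nonneg_left h hk.le]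
    exact (hanti ht).trans (le_mul_of_one_le_right hφ₀ (Real.one_le_exp hexponent))
  · have hflow (s : ℝ) (hs : s ∈ Icc t₁ t) := hα s (ht₁.trans hs.1)
    have hdecay : φ t ≤ φ t₁ * Real.exp (-k * (t - t₁)) := by
      refine le_mul_exp_of_hasDerivAt_le (fun s hs => (hasDerivAt_totalCurvature_flow
        (hflow s hs).1 (hflow s hs).2).sub_const _) (fun s hs => ?_) h
      have hsum_s := (sum_flow_eq (fun u hu => hα u hu.1)
        (right_mem_Icc.2 (ht₁.trans hs.1))).trans hsum
      linarith [hdiss (α s) (hflow s hs).1 hsum_s (hlower s hs.1)]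
    rw [show k * t₁ + -k * t = -k * (t - t₁) by ring]
    exact hdecay.trans (mul_le_mul_of_nonneg_right (hanti ht₁) (Real.exp_pos _).le)

lemma exists_norm_flow_sub_le :
    ∃ C > 0, ∃ c > 0, ∀ t ≥ 0, ‖α t - r‖ ≤ C * Real.exp (-c * t) := by
  obtain ⟨C, k, hk, hdecay⟩ :=
    exists_totalCurvature_flow_sub_le hrigid hr hα hsum hθ ht₁ hlower
  obtain ⟨m, hm, hgrowth⟩ := hrigid.exists_mul_norm_sq_le_totalCurvature_sub hr
  let C' := |C| / m + 1
  have hC' : 1 ≤ C' := le_add_of_nonneg_left (by positivity)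
  refine ⟨C', by linarith, k / 2, half_pos hk, fun t ht => ?_⟩
  have hsum_t := (sum_flow_eq (fun u hu => hα u hu.1) (right_mem_Icc.2 ht)).trans hsum
  have hsq : ‖α t - r‖ ^ 2 ≤ (C' * Real.exp (-(k / 2) * t)) ^ 2 := by
    calc ‖α t - r‖ ^ 2 ≤ C * Real.exp (-k * t) / m :=
          (le_div_iff₀' hm).2 ((hgrowth _ (hα t ht).1.1 hsum_t).trans (hdecay t ht))
      _ ≤ C' * Real.exp (-k * t) := by
          rw [mul_div_right_comm]
          gcongr
          exact (div_le_div_of_nonneg_right (le_abs_self C) hm.le).trans (by simp [C'])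
      _ ≤ C' ^ 2 * Real.exp (-k * t) := by
          gcongr
          exact le_self_pow₀ hC' two_ne_zero
      _ = (C' * Real.exp (-(k / 2) * t)) ^ 2 := by
          rw [mul_pow, ← Real.exp_nat_mul]
          ring_nf
  exact le_of_sq_le_sq hsq (by positivity)

end Convergence

lemma exists_flow_convergent_of_sum_eq (hr : IsConstantCurvaturePacking T r)
    (hr₀ : r₀ ∈ packings T) (hsum : ∑ i, r₀ i = ∑ i, r i)
    (hgap : (avgCurvature T r₀ : EReal) ≤ chi T r) :
    ∃ α : ℝ → V → ℝ, α 0 = r₀ ∧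
      (∀ t ≥ 0, α t ∈ packings T ∧ HasDerivAt α (flowField T (α t)) t) ∧
      ∃ rinf, IsConstantCurvaturePacking T rinf ∧
        ∃ C > 0, ∃ c > 0, ∀ t ≥ 0, ‖α t - rinf‖ ≤ C * Real.exp (-c * t) := by
  rcases le_or_gt (totalCurvature T r₀) (totalCurvature T r) with hle | hlt
  · have hconst := isConstantCurvaturePacking_of_totalCurvature_le hr hr₀ hsum hle
    refine ⟨fun _ => r₀, rfl, fun t _ => ⟨hr₀, ?_⟩, r₀, hconst, 1, one_pos, 1, one_pos,
      fun t _ => by simpa using (Real.exp_pos _).le⟩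
    rw [flowField_eq_zero hconst]
    exact hasDerivAt_const t r₀
  · obtain ⟨α, rfl, hα, μ, hμ, t₁, ht₁, hmem⟩ := exists_flow_eventually_mem_curvatureSublevel
      hr hr₀ hsum (dissipation_pos hr.1 hr₀ hsum hlt) hgap
    obtain ⟨θ, hθ, hlower⟩ := exists_mul_le_of_mem_curvatureSublevel hr hμ
    exact ⟨α, rfl, hα, r, hr, exists_norm_flow_sub_le
      (isRigid_of_mem_curvatureSublevel hr hμ (hmem t₁ le_rfl)) hr hα hsum hθ ht₁
      fun t ht => hlower _ (hmem t ht)⟩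

section Scaling

variable {c : ℝ} (hc : 0 < c)
include hc

lemma curvature_smul (hr : r ∈ packings T) : curvature T (c • r) = curvature T r := by
  rw [curvature_eq_extCurvature (smul_mem_packings hr hc), curvature_eq_extCurvature hr,
    extCurvature_smul r hc]

lemma avgCurvature_smul (hr : r ∈ packings T) : avgCurvature T (c • r) = avgCurvature T r := by
  simp only [avgCurvature, curvature_smul hc hr, Pi.smul_apply, smul_eq_mul, mul_left_comm _ c,
    ← Finset.mul_sum]
  exact mul_div_mul_left _ _ hc.ne'

lemma flowField_smul (hr : r ∈ packings T) : flowField T (c • r) = c • flowField T r := by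
  funext i
  simp only [flowField, curvature_smul hc hr, avgCurvature_smul hc hr, Pi.smul_apply, smul_eq_mul]
  ring

lemma IsConstantCurvaturePacking.smul (hr : IsConstantCurvaturePacking T r) :
    IsConstantCurvaturePacking T (c • r) :=
  ⟨smul_mem_packings hr.1 hc, by simpa only [curvature_smul hc hr.1] using hr.2⟩

end Scaling

lemma exists_flow_convergent (hr : IsConstantCurvaturePacking T r) (hr₀ : r₀ ∈ packings T)
    (hgap : (avgCurvature T r₀ : EReal) ≤ chi T r) :
    ∃ α : ℝ → V → ℝ, α 0 = r₀ ∧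
      (∀ t ≥ 0, α t ∈ packings T ∧ HasDerivAt α (flowField T (α t)) t) ∧
      ∃ rinf, IsConstantCurvaturePacking T rinf ∧
        ∃ C > 0, ∃ c > 0, ∀ t ≥ 0, ‖α t - rinf‖ ≤ C * Real.exp (-c * t) := by
  obtain ⟨c, hc, hsum⟩ : ∃ c : ℝ, 0 < c ∧ ∑ i, (c • r₀) i = ∑ i, r i := by
    rcases isEmpty_or_nonempty V with hV | hV
    · exact ⟨1, one_pos, by simp⟩
    have hpos {p : V → ℝ} (hp : p ∈ packings T) : 0 < ∑ i, p i :=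
      Finset.sum_pos (fun i _ => hp.1 i) Finset.univ_nonempty
    refine ⟨(∑ i, r i) / ∑ i, r₀ i, div_pos (hpos hr.1) (hpos hr₀), ?_⟩
    simp only [Pi.smul_apply, smul_eq_mul, ← Finset.mul_sum]
    exact div_mul_cancel₀ _ (hpos hr₀).ne'
  obtain ⟨α, hα₀, hα, rinf, hrinf, C, hC, k, hk, hdecay⟩ :=
    exists_flow_convergent_of_sum_eq hr (smul_mem_packings hr₀ hc) hsum
      (by rwa [avgCurvature_smul hc hr₀])
  have hc' := inv_pos.2 hc
  refine ⟨fun t => c⁻¹ • α t, ?_, fun t ht => ⟨smul_mem_packings (hα t ht).1 hc', ?_⟩,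
    c⁻¹ • rinf, hrinf.smul hc', c⁻¹ * C, mul_pos hc' hC, k, hk, fun t ht => ?_⟩
  · simp only [hα₀, inv_smul_smul₀ hc.ne']
  · rw [flowField_smul hc' (hα t ht).1]
    exact (hα t ht).2.const_smul c⁻¹
  · rw [← smul_sub, norm_smul, Real.norm_of_nonneg hc'.le, mul_assoc]
    exact mul_le_mul_of_nonneg_left (hdecay t ht) hc'.le

lemma IsNormalizedYamabeFlowOn.eqOn {β : ℝ → V → ℝ} {τ : ℝ}
    (hα : IsNormalizedYamabeFlowOn T α (Ico 0 τ)) (hβ : IsNormalizedYamabeFlowOn T β (Ico 0 τ))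
    (h₀ : α 0 = β 0) : EqOn α β (Ico 0 τ) := by
  rw [isNormalizedYamabeFlowOn_iff] at hα hβ
  intro t ht
  have hsub : Icc 0 t ⊆ Ico 0 τ := Icc_subset_Ico_right ht.2
  exact eqOn_of_isIntegralCurveOn (isOpen_packings T) (fun _ => contDiffAt_flowField)
    (hα.1.mono hsub) (hα.2.mono_left hsub) (hβ.1.mono hsub) (hβ.2.mono_left hsub) h₀
    (right_mem_Icc.2 ht.1)

end Limit

end BallPacking

end

open BallPacking in
theorem theorem1p2_general
    {V : Type*} [Fintype V] [DecidableEq V] (T : AbstractSimplicialComplex V)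
    (rhat : V → ℝ) (hrhat : IsConstantCurvaturePacking T rhat)
    (r₀ : V → ℝ) (hr₀ : r₀ ∈ packings T) (hgap : (avgCurvature T r₀ : EReal) ≤ chi T rhat) :
    ∃ r : ℝ → V → ℝ,
      r 0 = r₀ ∧
      IsNormalizedYamabeFlowOn T r (Ici 0) ∧
      (∀ (τ : ℝ) (s : ℝ → V → ℝ), s 0 = r₀ → IsNormalizedYamabeFlowOn T s (Ico 0 τ) →
        EqOn s r (Ico 0 τ)) ∧
      ∃ rinf : V → ℝ, IsConstantCurvaturePacking T rinf ∧
        ∃ C > 0, ∃ c > 0, ∀ t ≥ 0, ‖r t - rinf‖ ≤ C * Real.exp (-c * t) := by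
  obtain ⟨r, rfl, hr, hlimit⟩ := exists_flow_convergent hrhat hr₀ hgap
  have hflow : IsNormalizedYamabeFlowOn T r (Ici 0) := isNormalizedYamabeFlowOn_iff.2
    ⟨fun t ht => (hr t ht).2.hasDerivWithinAt, fun t ht => (hr t ht).1⟩
  exact ⟨r, rfl, hflow, fun τ s hs₀ hs => hs.eqOn (hflow.mono Ico_subset_Ici_self) hs₀,
    hlimit⟩

theorem theorem1p2
    {M : Type*} [TopologicalSpace M] [T2Space M] [CompactSpace M]
    [ChartedSpace (EuclideanSpace ℝ (Fin 3)) M]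
    {V : Type*} [Fintype V] [DecidableEq V] (T : AbstractSimplicialComplex V)
    (hT : BallPacking.Triangulates T M)
    (rhat : V → ℝ) (hrhat : BallPacking.IsConstantCurvaturePacking T rhat)
    (r₀ : V → ℝ) (hr₀ : r₀ ∈ BallPacking.packings T)
    (hgap : ((BallPacking.avgCurvature T r₀ : ℝ) : EReal) ≤ BallPacking.chi T rhat) :
    ∃ r : ℝ → V → ℝ,
      r 0 = r₀ ∧
      BallPacking.IsNormalizedYamabeFlowOn T r (Set.Ici 0) ∧
      (∀ (τ : ℝ) (s : ℝ → V → ℝ), s 0 = r₀ →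
        BallPacking.IsNormalizedYamabeFlowOn T s (Set.Ico 0 τ) →
        Set.EqOn s r (Set.Ico 0 τ)) ∧
      ∃ rinf : V → ℝ, BallPacking.IsConstantCurvaturePacking T rinf ∧
        ∃ C > 0, ∃ c > 0, ∀ t ≥ 0, ‖r t - rinf‖ ≤ C * Real.exp (-c * t) :=
  theorem1p2_general T rhat hrhat r₀ hr₀ hgap
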